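/- **Conventions.** An r.i. space $E$ is a rearrangement invariant Banach function space on $((0,\infty),dt)$ (axioms of Bennett–Sharpley, Fatou property included; $f^*\le g^*$ implies $\|f\|_E\le\|g\|_E$). $\widetilde E$ is the corresponding r.i. space on $((0,\infty),dt/t)$, i.e. $\|f\|_{\widetilde E}=\|f^{*}\|_E$ with $f^{*}$ the non-increasing rearrangement of $f$ with respect to $dt/t$, and $\|f\|_{\widetilde E(I)}=\|f\chi_I\|_{\widetilde E}$ for an interval $I\subset(0,\infty)$. A measurable function $\mathrm b:(0,\infty)\to(0,\infty)$ is slowly varying ($\mathrm b\in SV$) if for each $\varepsilon>0$ the function $t^{\varepsilon}\mathrm b(t)$ is equivalent to a non-decreasing function and $t^{-\varepsilon}\mathrm b(t)$ is equivalent to a non-increasing function on $(0,\infty)$. $\overline X=(X_0,X_1)$ is a couple of (quasi-)Banach spaces continuously embedded in a Hausdorff topological vector space, $$K(t,f;X_0,X_1)=\inf\{\|f_0\|_{X_0}+t\|f_1\|_{X_1}: f=f_0+f_1,\ f_i\in X_i\},\qquad K(t,f)=K(t,f;X_0,X_1),$$ and $\overline X^{\mathcal L}_{\theta,\mathrm b,E,a,F}$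 is the space of all $f\in X_0+X_1$ with $$\|f\|_{\mathcal L;\theta,\mathrm b,E,a,F}=\Big\|\mathrm b(t)\,\|s^{-\theta}a(s)K(s,f)\|_{\widetilde F(0,t)}\Big\|_{\widetilde E}<\infty .$$ **Theorem.** Let $0<\theta_0<\theta_1<1$. Let $E_0,E_1,F_0,F_1$ be r.i. spaces and $a_0,a_1,\mathrm b_0,\mathrm b_1\in SV$ with $\|\mathrm b_0\|_{\widetilde E_0(1,\infty)}<\infty$ and $\|\mathrm b_1\|_{\widetilde E_1(1,\infty)}<\infty$. Put $$\rho(u)=u^{\theta_1-\theta_0}\,\frac{a_0(u)\,\|\mathrm b_0\|_{\widetilde E_0(u,\infty)}}{a_1(u)\,\|\mathrm b_1\|_{\widetilde E_1(u,\infty)}},\qquad u>0 .$$ Then $0<\rho(u)<\infty$ for all $u>0$, and for every $f\in \overline X^{\mathcal L}_{\theta_0,\mathrm b_0,E_0,a_0,F_0}+\overline X^{\mathcal L}_{\theta_1,\mathrm b_1,E_1,a_1,F_1}$ and $u>0$ $$\begin{aligned} K\big(\rho(u),f;\overline X^{\mathcal L}_{\theta_0,\mathrm b_0,E_0,a_0,F_0},\overline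 X^{\mathcal L}_{\theta_1,\mathrm b_1,E_1,a_1,F_1}\big) &\sim\Big\|\mathrm b_0(t)\,\|s^{-\theta_0}a_0(s)K(s,f)\|_{\widetilde F_0(0,t)}\Big\|_{\widetilde E_0(0,u)}\\ &\quad+\|\mathrm b_0\|_{\widetilde E_0(u,\infty)}\,\|t^{-\theta_0}a_0(t)K(t,f)\|_{\widetilde F_0(0,u)}\\ &\quad+\rho(u)\Big\|\mathrm b_1(t)\,\|s^{-\theta_1}a_1(s)K(s,f)\|_{\widetilde F_1(u,t)}\Big\|_{\widetilde E_1(u,\infty)}, \end{aligned}$$ where $\sim$ means that each side is at most a positive constant, independent of $f$ and $u$, times the other. -/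

import Mathlib

open MeasureTheory Set Filter Topology
open scoped ENNReal NNReal

noncomputable section

namespace Holmstedt

/-! ### Rearrangement invariant spaces on the half-line -/

/-- Lebesgue measure `dt` on `(0,∞)`. Functions on `(0,∞)` are functions on `ℝ` whose values
outside `(0,∞)` play no role. -/
def halfLine : Measure ℝ := volume.restrict (Ioi 0)

/-- The homogeneous measure `dt/t` on `(0,∞)`. -/
def homMeasure : Measure ℝ := halfLine.withDensity fun t => ENNReal.ofReal t⁻¹

/-- The non-increasing rearrangement `f^*` of a non-negative function `f` with respect to `μ`:
`f^*(t) = inf {l : μ {f > l} ≤ t}`. -/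
def rearr (μ : Measure ℝ) (f : ℝ → ℝ≥0∞) (t : ℝ) : ℝ≥0∞ :=
  sInf {l : ℝ≥0∞ | μ {x | l < f x} ≤ ENNReal.ofReal t}

/-- A rearrangement invariant Banach function space on `((0,∞), dt)`, given by its function norm
on the non-negative (Lebesgue) measurable functions: the axioms of Bennett and Sharpley,
Fatou property included, and monotonicity with respect to `f^* ≤ g^*`.
The norm of a measurable `f` is the value at `|f|`, and `f` is in the space iff it is finite. -/
structure RISpace where
  /-- the function norm -/
  norm : (ℝ → ℝ≥0∞) → ℝ≥0∞
  norm_eq_zero_iff : ∀ f, AEMeasurable f halfLine → (norm f = 0 ↔ f =ᵐ[halfLine] 0)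
  norm_smul : ∀ (c : ℝ≥0) (f : ℝ → ℝ≥0∞), AEMeasurable f halfLine →
    norm (fun x => c * f x) = c * norm f
  norm_add_le : ∀ f g, AEMeasurable f halfLine → AEMeasurable g halfLine →
    norm (fun x => f x + g x) ≤ norm f + norm g
  norm_mono : ∀ f g, AEMeasurable f halfLine → AEMeasurable g halfLine →
    f ≤ᵐ[halfLine] g → norm f ≤ norm g
  /-- Fatou property -/
  norm_iSup : ∀ f : ℕ → ℝ → ℝ≥0∞, (∀ n, AEMeasurable (f n) halfLine) →
    (∀ᵐ x ∂halfLine, Monotone fun n => f n x) → norm (fun x => ⨆ n, f n x) = ⨆ n, norm (f n)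
  norm_indicator_lt_top : ∀ s, MeasurableSet s → halfLine s < ∞ →
    norm (s.indicator fun _ => 1) < ∞
  lintegral_le : ∀ s, MeasurableSet s → halfLine s < ∞ →
    ∃ C : ℝ≥0, ∀ f, AEMeasurable f halfLine → ∫⁻ x in s, f x ∂halfLine ≤ C * norm f
  /-- rearrangement invariance -/
  norm_le_of_rearr_le : ∀ f g, AEMeasurable f halfLine → AEMeasurable g halfLine →
    (∀ t, 0 < t → rearr halfLine f t ≤ rearr halfLine g t) → norm f ≤ norm g

/-- The norm of `Ẽ`, the r.i. space on `((0,∞), dt/t)` that corresponds to `E`: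
`‖f‖_Ẽ = ‖f^*‖_E`, where `f^*` is the rearrangement with respect to `dt/t`.
(`((0,∞), dt/t)` and `((0,∞), dt)` are isomorphic measure spaces, so that any interpolation
functor which produces `E` from `(L₁, L_∞)` produces this space from `(L̃₁, L_∞)`.) -/
def RISpace.tilde (E : RISpace) (f : ℝ → ℝ≥0∞) : ℝ≥0∞ :=
  E.norm (rearr homMeasure f)

/-- The norm of `Ẽ(I)`, for an interval `I ⊆ (0,∞)`: the norm in `Ẽ` of the extension by zero of
the restriction to `I`. -/
def RISpace.tildeOn (E : RISpace) (I : Set ℝ) (f : ℝ → ℝ≥0∞) : ℝ≥0∞ :=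
  E.tilde (I.indicator f)

/-! ### Slowly varying functions -/

/-- `f ∼ g` on `(0,∞)`, for real functions. -/
def EquivOn (f g : ℝ → ℝ) : Prop :=
  ∃ c C : ℝ, 0 < c ∧ 0 < C ∧ ∀ t, 0 < t → c * g t ≤ f t ∧ f t ≤ C * g t

/-- Slowly varying functions on `(0,∞)`. -/
structure SlowlyVarying (b : ℝ → ℝ) : Prop where
  pos : ∀ t, 0 < t → 0 < b t
  aemeasurable : AEMeasurable b halfLine
  equiv_monotone : ∀ ε : ℝ, 0 < ε →
    ∃ g : ℝ → ℝ, MonotoneOn g (Ioi 0) ∧ EquivOn (fun t => t ^ ε * b t) g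
  equiv_antitone : ∀ ε : ℝ, 0 < ε →
    ∃ g : ℝ → ℝ, AntitoneOn g (Ioi 0) ∧ EquivOn (fun t => t ^ (-ε) * b t) g

/-- A positive function on `(0,∞)` as an extended non-negative one. -/
def ennFun (b : ℝ → ℝ) (t : ℝ) : ℝ≥0∞ := ENNReal.ofReal (b t)

/-! ### Quasi-Banach couples and the K-functional

A quasi-normed space `X` inside a vector space `V` is given by its extended quasi-norm
`N : V → [0,∞]`, equal to `‖f‖_X` for `f ∈ X` and to `∞` for `f ∉ X`. -/

/-- `N` is the extended quasi-norm of a quasi-Banach space that is continuously embedded in the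
topological vector space `V`. -/
structure IsQuasiBanach (𝕜 : Type*) {V : Type*} [RCLike 𝕜] [AddCommGroup V] [Module 𝕜 V]
    [TopologicalSpace V] (N : V → ℝ≥0∞) : Prop where
  eq_zero : ∀ f, N f = 0 → f = 0
  smul : ∀ (c : 𝕜) (f : V), N (c • f) = ‖c‖ₑ * N f
  add_le : ∃ κ : ℝ≥0, ∀ f g, N (f + g) ≤ κ * (N f + N g)
  complete : ∀ f : ℕ → V, (∀ n, N (f n) < ∞) →
    (∀ ε : ℝ≥0∞, 0 < ε → ∃ n₀, ∀ m ≥ n₀, ∀ n ≥ n₀, N (f m - f n) < ε) →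
    ∃ g, N g < ∞ ∧ Tendsto (fun n => N (f n - g)) atTop (𝓝 0)
  continuous_embedding : ∀ U ∈ 𝓝 (0 : V), ∃ ε : ℝ≥0∞, 0 < ε ∧ ∀ f, N f < ε → f ∈ U

section Couples

variable {V : Type*} [AddCommGroup V]

/-- `f ∈ X₀ + X₁`. -/
def MemSum (N₀ N₁ : V → ℝ≥0∞) (f : V) : Prop :=
  ∃ f₀ f₁ : V, f = f₀ + f₁ ∧ N₀ f₀ < ∞ ∧ N₁ f₁ < ∞

/-- The Peetre K-functional `K(t, f; X₀, X₁)`. (Decompositions with a piece outside its space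
contribute `∞` to the infimum.) -/
def K (N₀ N₁ : V → ℝ≥0∞) (t : ℝ≥0∞) (f : V) : ℝ≥0∞ :=
  ⨅ (f₀ : V) (f₁ : V) (_ : f = f₀ + f₁), N₀ f₀ + t * N₁ f₁

/-- The function `s ↦ s^{-θ} a(s) K(s, f; X₀, X₁)` on `(0,∞)`. -/
def wK (N₀ N₁ : V → ℝ≥0∞) (θ : ℝ) (a : ℝ → ℝ) (f : V) (s : ℝ) : ℝ≥0∞ :=
  ENNReal.ofReal (s ^ (-θ)) * ENNReal.ofReal (a s) * K N₀ N₁ (ENNReal.ofReal s) f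

open Classical in
/-- The extended quasi-norm of the space `(X₀, X₁)^𝓛_{θ,b,E,a,F}`:
`‖ b(t) ‖ s^{-θ} a(s) K(s,f) ‖_{F̃(0,t)} ‖_Ẽ` for `f ∈ X₀ + X₁`, and `∞` for other `f`. -/
def normL (N₀ N₁ : V → ℝ≥0∞) (θ : ℝ) (b : ℝ → ℝ) (E : RISpace) (a : ℝ → ℝ) (F : RISpace)
    (f : V) : ℝ≥0∞ :=
  if MemSum N₀ N₁ f then
    E.tilde fun t => ennFun b t * F.tildeOn (Ioo 0 t) (wK N₀ N₁ θ a f)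
  else ∞

end Couples

/-- `ρ(u) = u^{θ₁-θ₀} a₀(u) ‖b₀‖_{Ẽ₀(u,∞)} / (a₁(u) ‖b₁‖_{Ẽ₁(u,∞)})`. -/
def rho (θ₀ θ₁ : ℝ) (a₀ a₁ b₀ b₁ : ℝ → ℝ) (E₀ E₁ : RISpace) (u : ℝ) : ℝ≥0∞ :=
  ENNReal.ofReal (u ^ (θ₁ - θ₀)) *
    ((ennFun a₀ u * E₀.tildeOn (Ioi u) (ennFun b₀)) / (ennFun a₁ u * E₁.tildeOn (Ioi u) (ennFun b₁)))

end Holmstedt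

end

noncomputable section

namespace Holmstedt

/-! ### Rearrangements -/

/-! The function `k(s) = K(s,f)` is quasi-concave, and under r.i. norms for `dt/t` a weight `w` of
regular variation behaves as a power does under an integral: if its index is positive, its norm on
`(0,t)` is at most a constant times `w(t)`; if negative, the same holds on `(t,∞)`
(`tildeOn_Ioo_le`, `tildeOn_Ioi_le`). Conversely `w(t)` is always dominated by either norm. The
tails of `b₀`, `b₁` are again slowly varying (`RegVar.tail`), so every weight in the formula is of
this kind.

Formula bounded by K: the formula is quasi-subadditive in `k`, so for `f = f₀ + f₁` the parts are
treated separately (`formula_le_total_fst`, `formula_le_total_snd`). Both estimates rest on the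
pointwise bound `le_total`, `k ≤ C‖f‖ / (v · tail)`; `θ₀ < θ₁` fixes the sign of each index.

K bounded by formula: take a decomposition nearly optimal at `u` for the couple `(X₀, X₁)`. Up to
constants, `K(s,f₀)` is at most `k(s)` for `s ≤ u` and `k(u)` everywhere, while `K(s,f₁)` is at most
`(s/u) k(u)` for `s ≤ u` and `k(s)` beyond. Inserting this in the two norms (`total_fst_le`,
`total_snd_le`) yields the outer terms of the formula and boundary terms in `k(u)`, which the middle
term absorbs since `v₀(u) k(u)` is dominated by the inner norm on `(0,u)`. -/

theorem lt_rearr_iff (μ : Measure ℝ) (f : ℝ → ℝ≥0∞) (t : ℝ) (l : ℝ≥0∞) :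
    l < rearr μ f t ↔ ENNReal.ofReal t < μ {x | l < f x} := by
  constructor
  · intro h
    by_contra! hle
    exact absurd (sInf_le (s := {l : ℝ≥0∞ | μ {x | l < f x} ≤ ENNReal.ofReal t}) hle) (not_le.2 h)
  · intro h
    by_contra! hle
    refine absurd h (not_lt.2 ?_)
    rcases eq_or_ne l ∞ with rfl | hl
    · simp
    -- Right-continuity of the distribution function: approach `l` strictly from above.
    obtain ⟨u, hu, hul, hlim⟩ := exists_seq_strictAnti_tendsto' (lt_top_iff_ne_top.2 hl)
    have hset : {x | l < f x} = ⋃ n, {x | u n < f x} := by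
      ext x
      simp only [mem_ofPred_eq, mem_iUnion]
      exact ⟨fun hx => (hlim.eventually_lt_const hx).exists, fun ⟨n, hn⟩ => (hul n).1.trans hn⟩
    have hmono : Monotone fun n => {x | u n < f x} :=
      fun m n hmn x hx => (hu.antitone hmn).trans_lt hx
    rw [hset, hmono.measure_iUnion]
    refine iSup_le fun n => ?_
    obtain ⟨m, hm, hmu⟩ := sInf_lt_iff.1 (hle.trans_lt (hul n).1)
    exact (measure_mono fun x hx => hmu.trans hx).trans hm

theorem rearr_congr {μ ν : Measure ℝ} {f g : ℝ → ℝ≥0∞}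
    (h : ∀ l, μ {x | l < f x} = ν {x | l < g x}) : rearr μ f = rearr ν g := by
  funext t
  simp only [rearr, h]

theorem rearr_mono {μ : Measure ℝ} {f g : ℝ → ℝ≥0∞} (h : f ≤ᵐ[μ] g) (t : ℝ) :
    rearr μ f t ≤ rearr μ g t := by
  refine sInf_le_sInf fun l hl => (measure_mono_ae ?_).trans hl
  filter_upwards [h] with x hx hlx using lt_of_lt_of_le hlx hx

theorem rearr_antitone (μ : Measure ℝ) (f : ℝ → ℝ≥0∞) : Antitone (rearr μ f) :=
  fun _ _ hst => sInf_le_sInf fun _ hl => le_trans hl (ENNReal.ofReal_le_ofReal hst)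

/-- By `lt_rearr_iff` the superlevel set of `f^*` is an initial interval whose length is the measure
of that of `f`. -/
theorem halfLine_lt_rearr (μ : Measure ℝ) (f : ℝ → ℝ≥0∞) (l : ℝ≥0∞) :
    halfLine {x | l < rearr μ f x} = μ {x | l < f x} := by
  simp only [lt_rearr_iff]
  set m := μ {x | l < f x}
  have hmeas : MeasurableSet {x : ℝ | ENNReal.ofReal x < m} :=
    measurableSet_lt ENNReal.measurable_ofReal measurable_const
  rw [halfLine, Measure.restrict_apply hmeas]
  rcases eq_or_ne m ∞ with hm | hm
  · simp [hm]
  · have : {x : ℝ | ENNReal.ofReal x < m} ∩ Ioi 0 = Ioo 0 m.toReal := by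
      ext x
      simp only [mem_inter_iff, mem_ofPred_eq, mem_Ioi, mem_Ioo]
      refine ⟨fun h => ⟨h.2, (ENNReal.ofReal_lt_iff_lt_toReal h.2.le hm).1 h.1⟩,
        fun h => ⟨(ENNReal.ofReal_lt_iff_lt_toReal h.1.le hm).2 h.2, h.1⟩⟩
    rw [this, Real.volume_Ioo, sub_zero, ENNReal.ofReal_toReal hm]

theorem rearr_rearr (μ : Measure ℝ) (f : ℝ → ℝ≥0∞) :
    rearr halfLine (rearr μ f) = rearr μ f :=
  rearr_congr (halfLine_lt_rearr μ f)

/-! ### The homogeneous measure -/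

/-- The Jacobian `e^x` of the exponential cancels the density `1/t`, so dilation and inversion below
become translation and reflection. -/
theorem homMeasure_eq_map : homMeasure = (volume : Measure ℝ).map Real.exp := by
  ext s hs
  rw [Measure.map_apply Real.measurable_exp hs, homMeasure, withDensity_apply _ hs, halfLine,
    Measure.restrict_restrict hs]
  have himg : s ∩ Ioi 0 = Real.exp '' (Real.exp ⁻¹' s) := by
    rw [image_preimage_eq_inter_range, Real.range_exp]
  rw [himg, lintegral_image_eq_lintegral_abs_deriv_mul (Real.measurable_exp hs)
    (fun x _ => (Real.hasDerivAt_exp x).hasDerivWithinAt) Real.exp_injective.injOn]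
  have : ∀ x : ℝ, ENNReal.ofReal |Real.exp x| * ENNReal.ofReal (Real.exp x)⁻¹ = 1 := fun x => by
    rw [abs_of_pos (Real.exp_pos x), ← ENNReal.ofReal_mul (Real.exp_pos x).le,
      mul_inv_cancel₀ (Real.exp_pos x).ne', ENNReal.ofReal_one]
  simp only [this, lintegral_one, Measure.restrict_apply_univ]

theorem measurePreserving_exp : MeasurePreserving Real.exp volume homMeasure :=
  ⟨Real.measurable_exp, homMeasure_eq_map.symm⟩

theorem homMeasure_absolutelyContinuous : homMeasure ≪ halfLine :=
  withDensity_absolutelyContinuous _ _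

theorem ae_homMeasure_pos : ∀ᵐ x ∂homMeasure, 0 < x :=
  homMeasure_absolutelyContinuous.ae_le (ae_restrict_mem measurableSet_Ioi)

theorem homMeasure_singleton (u : ℝ) : homMeasure {u} = 0 :=
  homMeasure_absolutelyContinuous (by simp [halfLine])

theorem measurePreserving_mul_left {c : ℝ} (hc : 0 < c) :
    MeasurePreserving (fun x => c * x) homMeasure homMeasure := by
  refine ⟨measurable_const_mul c, ?_⟩
  rw [homMeasure_eq_map, Measure.map_map (measurable_const_mul c) Real.measurable_exp]
  have : (fun x => c * x) ∘ Real.exp = Real.exp ∘ fun x => Real.log c + x := by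
    funext x
    simp [Real.exp_add, Real.exp_log hc]
  rw [this, ← Measure.map_map Real.measurable_exp (measurable_const_add _),
    (measurePreserving_add_left volume (Real.log c)).map_eq]

theorem measurePreserving_inv : MeasurePreserving (fun x : ℝ => x⁻¹) homMeasure homMeasure := by
  refine ⟨measurable_inv, ?_⟩
  rw [homMeasure_eq_map, Measure.map_map measurable_inv Real.measurable_exp]
  have : (fun x : ℝ => x⁻¹) ∘ Real.exp = Real.exp ∘ fun x => -x := by
    funext x
    simp [Real.exp_neg]
  rw [this, ← Measure.map_map Real.measurable_exp measurable_neg,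
    (Measure.measurePreserving_neg volume).map_eq]

/-- A measure preserving map of the half-line onto the line, which permutes unit intervals. -/
def unfold (t : ℝ) : ℝ := ((Equiv.intEquivNat.symm ⌊t⌋₊ : ℤ) : ℝ) + (t - ⌊t⌋₊)

theorem measurable_unfold : Measurable unfold := by
  have h : Measurable fun t : ℝ => ⌊t⌋₊ := Nat.measurable_floor
  exact ((measurable_from_nat (f := fun n => ((Equiv.intEquivNat.symm n : ℤ) : ℝ))).comp h).add
    (measurable_id.sub ((measurable_from_nat (f := fun n => (n : ℝ))).comp h))

/-- Both measures split over unit intervals, and on the `n`-th one `unfold` is a translation onto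
the interval of the integer paired with `n`. -/
theorem measurePreserving_unfold : MeasurePreserving unfold halfLine volume := by
  refine ⟨measurable_unfold, ?_⟩
  ext s hs
  rw [Measure.map_apply measurable_unfold hs, halfLine,
    -- Adding the null point `0` makes the half-line a union of the intervals `[n, n+1)`.
    Measure.restrict_congr_set (Ioi_ae_eq_Ici (μ := volume) (a := (0 : ℝ)))]
  have h1 : Ici (0 : ℝ) = ⋃ n : ℕ, Ico (n : ℝ) (n + 1) := by
    ext x
    simp only [mem_Ici, mem_iUnion, mem_Ico]
    exact ⟨fun hx => ⟨⌊x⌋₊, Nat.floor_le hx, Nat.lt_floor_add_one x⟩,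
      fun ⟨n, hn, _⟩ => n.cast_nonneg.trans hn⟩
  have hd : Pairwise (Function.onFun Disjoint fun n : ℕ => Ico (n : ℝ) (n + 1)) := by
    have := pairwise_disjoint_Ico_intCast ℝ
    intro m n hmn
    have := this (i := (m : ℤ)) (j := (n : ℤ)) (by exact_mod_cast hmn)
    simpa [Function.onFun] using this
  have h2 : (univ : Set ℝ) = ⋃ k : ℤ, Ico (k : ℝ) (k + 1) := (iUnion_Ico_intCast ℝ).symm
  have hL : (volume.restrict (Ici (0 : ℝ))) (unfold ⁻¹' s)
      = ∑' n : ℕ, volume (unfold ⁻¹' s ∩ Ico (n : ℝ) (n + 1)) := by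
    rw [h1, Measure.restrict_iUnion hd fun _ => measurableSet_Ico,
      Measure.sum_apply _ (measurable_unfold hs)]
    exact tsum_congr fun n => Measure.restrict_apply (measurable_unfold hs)
  have hR : volume s = ∑' k : ℤ, volume (s ∩ Ico (k : ℝ) (k + 1)) := by
    conv_lhs => rw [← Measure.restrict_univ (μ := (volume : Measure ℝ)), h2]
    rw [Measure.restrict_iUnion (pairwise_disjoint_Ico_intCast ℝ) fun _ => measurableSet_Ico,
      Measure.sum_apply _ hs]
    exact tsum_congr fun n => Measure.restrict_apply hs
  rw [hL, hR, ← Equiv.tsum_eq Equiv.intEquivNat.symm]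
  refine tsum_congr fun n => ?_
  set k : ℤ := Equiv.intEquivNat.symm n
  have : unfold ⁻¹' s ∩ Ico (n : ℝ) (n + 1)
      = (fun x => ((k : ℝ) - n) + x) ⁻¹' (s ∩ Ico (k : ℝ) (k + 1)) := by
    ext x
    simp only [mem_inter_iff, mem_preimage, mem_Ico]
    have e : ((k : ℝ) ≤ k - n + x ∧ (k : ℝ) - n + x < k + 1) ↔ ((n : ℝ) ≤ x ∧ x < n + 1) := by
      constructor <;> rintro ⟨h, h'⟩ <;> constructor <;> linarith
    rw [e]
    refine and_congr_left fun hx => ?_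
    have hf : ⌊x⌋₊ = n := (Nat.floor_eq_iff (n.cast_nonneg.trans hx.1)).2 hx
    have : unfold x = k - n + x := by
      rw [unfold, hf]; ring
    rw [this]
  rw [this, measure_preimage_add]

/-- A measure preserving map from `((0,∞), dt)` to `((0,∞), dt/t)`. -/
def transfer (t : ℝ) : ℝ := Real.exp (unfold t)

theorem measurePreserving_transfer : MeasurePreserving transfer halfLine homMeasure :=
  measurePreserving_exp.comp measurePreserving_unfold

/-! ### The norm of the transferred space -/

namespace RISpace

variable (E : RISpace)

/-- Composition with `transfer` preserves the distribution, and the norm depends only on the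
rearrangement. The function norm axioms thus pass to `tilde`; subadditivity is not visible from
`f^*`. -/
theorem tilde_eq_norm_comp {f : ℝ → ℝ≥0∞} (hf : AEMeasurable f homMeasure) :
    E.tilde f = E.norm (f ∘ transfer) := by
  have hlev : ∀ l, halfLine {x | l < (f ∘ transfer) x} = homMeasure {x | l < f x} := fun l =>
    measurePreserving_transfer.measure_preimage
      (nullMeasurableSet_lt aemeasurable_const hf)
  have h : rearr halfLine (rearr homMeasure f) = rearr halfLine (f ∘ transfer) := by
    rw [rearr_rearr, rearr_congr hlev]
  have hm := (rearr_antitone homMeasure f).measurable.aemeasurable (μ := halfLine)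
  have hm' := hf.comp_quasiMeasurePreserving
      measurePreserving_transfer.quasiMeasurePreserving
  exact le_antisymm (E.norm_le_of_rearr_le _ _ hm hm' fun t _ => (congrFun h t).le)
    (E.norm_le_of_rearr_le _ _ hm' hm fun t _ => (congrFun h t).ge)

/-- No measurability of `f`, `g` is needed, since rearrangements are monotone and so always
measurable. -/
theorem tilde_mono {f g : ℝ → ℝ≥0∞} (h : f ≤ᵐ[homMeasure] g) : E.tilde f ≤ E.tilde g :=
  E.norm_mono _ _ (rearr_antitone _ _).measurable.aemeasurable
    (rearr_antitone _ _).measurable.aemeasurable (Eventually.of_forall (rearr_mono h))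

theorem tilde_zero : E.tilde 0 = 0 := by
  have h : AEMeasurable (0 : ℝ → ℝ≥0∞) homMeasure := aemeasurable_const
  rw [E.tilde_eq_norm_comp h]
  exact (E.norm_eq_zero_iff (fun _ => 0) aemeasurable_const).2 (Eventually.of_forall fun _ => rfl)

theorem tilde_ne_zero {s : Set ℝ} (hs : MeasurableSet s) (h : homMeasure s ≠ 0) :
    E.tilde (s.indicator fun _ => 1) ≠ 0 := by
  have hm : AEMeasurable (s.indicator fun _ => (1 : ℝ≥0∞)) homMeasure :=
    aemeasurable_const.indicator hs
  rw [E.tilde_eq_norm_comp hm, Ne, E.norm_eq_zero_iff _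
    (hm.comp_quasiMeasurePreserving
      measurePreserving_transfer.quasiMeasurePreserving)]
  intro h0
  refine h ?_
  rw [← measurePreserving_transfer.measure_preimage hs.nullMeasurableSet]
  refine measure_mono_null (fun x hx => ?_) (ae_iff.1 h0)
  have hx' : transfer x ∈ s := hx
  simp [hx']

theorem tilde_indicator_lt_top {s : Set ℝ} (hs : MeasurableSet s) (h : homMeasure s < ∞) :
    E.tilde (s.indicator fun _ => 1) < ∞ := by
  rw [E.tilde_eq_norm_comp (aemeasurable_const.indicator hs)]
  refine E.norm_indicator_lt_top (transfer ⁻¹' s) (measurePreserving_transfer.measurable hs) ?_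
  rwa [measurePreserving_transfer.measure_preimage hs.nullMeasurableSet]

theorem tilde_add_le {f g : ℝ → ℝ≥0∞} (hf : AEMeasurable f homMeasure)
    (hg : AEMeasurable g homMeasure) :
    E.tilde (fun x => f x + g x) ≤ E.tilde f + E.tilde g := by
  rw [E.tilde_eq_norm_comp hf, E.tilde_eq_norm_comp hg,
    E.tilde_eq_norm_comp (f := fun x => f x + g x) (hf.add hg)]
  exact E.norm_add_le _ _ (hf.comp_quasiMeasurePreserving
      measurePreserving_transfer.quasiMeasurePreserving)
    (hg.comp_quasiMeasurePreserving
      measurePreserving_transfer.quasiMeasurePreserving)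

theorem tilde_iSup {f : ℕ → ℝ → ℝ≥0∞} (hf : ∀ n, AEMeasurable (f n) homMeasure)
    (hmono : ∀ x, Monotone fun n => f n x) :
    E.tilde (fun x => ⨆ n, f n x) = ⨆ n, E.tilde (f n) := by
  rw [E.tilde_eq_norm_comp (.iSup hf)]
  simp_rw [fun n => E.tilde_eq_norm_comp (hf n)]
  exact E.norm_iSup (fun n => f n ∘ transfer)
    (fun n => (hf n).comp_quasiMeasurePreserving
      measurePreserving_transfer.quasiMeasurePreserving)
    (Eventually.of_forall fun x => hmono _)

theorem tilde_const_mul (c : ℝ≥0∞) {f : ℝ → ℝ≥0∞} (hf : AEMeasurable f homMeasure) :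
    E.tilde (fun x => c * f x) = c * E.tilde f := by
  have hfin : ∀ c : ℝ≥0, E.tilde (fun x => c * f x) = c * E.tilde f := fun c => by
    rw [E.tilde_eq_norm_comp hf, E.tilde_eq_norm_comp (hf.const_mul _)]
    exact E.norm_smul c _ (hf.comp_quasiMeasurePreserving
      measurePreserving_transfer.quasiMeasurePreserving)
  induction c with
  | coe c => exact hfin c
  | top =>
    -- Homogeneity is an axiom for finite constants only; the Fatou property extends it to `∞`.
    have htop : (∞ : ℝ≥0∞) = ⨆ n : ℕ, ((n : ℝ≥0) : ℝ≥0∞) := by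
      simpa using ENNReal.iSup_natCast.symm
    have h := E.tilde_iSup (f := fun (n : ℕ) x => ((n : ℝ≥0) : ℝ≥0∞) * f x)
      (fun n => hf.const_mul _) (fun x m n hmn => by
        dsimp only
        gcongr)
    simp_rw [hfin, ← ENNReal.iSup_mul, ← htop] at h
    exact h

theorem tilde_sum_le {f : ℕ → ℝ → ℝ≥0∞} (hf : ∀ n, AEMeasurable (f n) homMeasure) (N : ℕ) :
    E.tilde (fun x => ∑ n ∈ Finset.range N, f n x) ≤ ∑ n ∈ Finset.range N, E.tilde (f n) := by
  induction N with
  | zero =>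
    simp only [Finset.range_zero, Finset.sum_empty]
    exact E.tilde_zero.le
  | succ N ih =>
    simp only [Finset.sum_range_succ]
    refine (E.tilde_add_le (Finset.aemeasurable_fun_sum _ fun n _ => hf n) (hf N)).trans ?_
    gcongr

theorem tilde_tsum_le {f : ℕ → ℝ → ℝ≥0∞} (hf : ∀ n, AEMeasurable (f n) homMeasure) :
    E.tilde (fun x => ∑' n, f n x) ≤ ∑' n, E.tilde (f n) := by
  simp only [ENNReal.tsum_eq_iSup_nat]
  rw [E.tilde_iSup fun N => Finset.aemeasurable_fun_sum _ fun n _ => hf n]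
  · exact iSup_mono fun N => E.tilde_sum_le hf N
  · intro x M N h
    exact Finset.sum_le_sum_of_subset (Finset.range_mono h)

theorem tilde_comp {T : ℝ → ℝ} (hT : MeasurePreserving T homMeasure homMeasure) {f : ℝ → ℝ≥0∞}
    (hf : AEMeasurable f homMeasure) : E.tilde (f ∘ T) = E.tilde f := by
  unfold tilde
  congr 1
  exact rearr_congr fun l => hT.measure_preimage (nullMeasurableSet_lt aemeasurable_const hf)

/-! ### Restriction to sets -/

theorem tildeOn_mono {I J : Set ℝ} {f g : ℝ → ℝ≥0∞} (hIJ : I ⊆ J) (h : ∀ x ∈ I, f x ≤ g x) :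
    E.tildeOn I f ≤ E.tildeOn J g := by
  refine E.tilde_mono (Eventually.of_forall fun x => ?_)
  refine (indicator_le_indicator' (fun hx => h x hx)).trans ?_
  exact indicator_le_indicator_of_subset hIJ (fun _ => zero_le) x

theorem tildeOn_const_mul {I : Set ℝ} (hI : MeasurableSet I) (c : ℝ≥0∞) {f : ℝ → ℝ≥0∞}
    (hf : AEMeasurable f homMeasure) :
    E.tildeOn I (fun x => c * f x) = c * E.tildeOn I f := by
  unfold tildeOn
  rw [← E.tilde_const_mul c (hf.indicator hI)]
  congr 1
  funext x
  by_cases hx : x ∈ I <;> simp [hx]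

theorem tildeOn_le_const_mul {I : Set ℝ} (hI : MeasurableSet I) {c : ℝ≥0∞} {f g : ℝ → ℝ≥0∞}
    (hg : AEMeasurable g homMeasure) (h : ∀ x ∈ I, f x ≤ c * g x) :
    E.tildeOn I f ≤ c * E.tildeOn I g :=
  (E.tildeOn_mono subset_rfl h).trans_eq (E.tildeOn_const_mul hI c hg)

theorem tildeOn_add_le {I : Set ℝ} (hI : MeasurableSet I) {f g : ℝ → ℝ≥0∞}
    (hf : AEMeasurable f homMeasure) (hg : AEMeasurable g homMeasure) :
    E.tildeOn I (fun x => f x + g x) ≤ E.tildeOn I f + E.tildeOn I g := by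
  unfold tildeOn
  refine le_of_eq_of_le ?_ (E.tilde_add_le (hf.indicator hI) (hg.indicator hI))
  congr 1
  exact indicator_add I f g

/-- An almost everywhere covering suffices, so cut points may be dropped. -/
theorem tildeOn_le_add {I J L : Set ℝ} (hI : MeasurableSet I) (hJ : MeasurableSet J)
    (hL : ∀ᵐ x ∂homMeasure, x ∈ L → x ∈ I ∨ x ∈ J) {f : ℝ → ℝ≥0∞}
    (hf : AEMeasurable f homMeasure) :
    E.tildeOn L f ≤ E.tildeOn I f + E.tildeOn J f := by
  refine le_trans (E.tilde_mono ?_) (E.tilde_add_le (hf.indicator hI) (hf.indicator hJ))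
  filter_upwards [hL] with x hx
  by_cases hxL : x ∈ L
  · rcases hx hxL with h | h
    · simp [hxL, h]
    · simp [hxL, h]
  · simp [hxL]

theorem tildeOn_univ (f : ℝ → ℝ≥0∞) : E.tildeOn univ f = E.tilde f := by
  rw [tildeOn, indicator_univ]

theorem tildeOn_le_tilde (I : Set ℝ) (f : ℝ → ℝ≥0∞) : E.tildeOn I f ≤ E.tilde f := by
  rw [← tildeOn_univ]
  exact E.tildeOn_mono (subset_univ I) fun _ _ => le_rfl

theorem ae_homMeasure_ne (u : ℝ) : ∀ᵐ x ∂homMeasure, x ≠ u := by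
  simp [ae_iff, homMeasure_singleton]

theorem tilde_le_add (u : ℝ) {f : ℝ → ℝ≥0∞} (hf : AEMeasurable f homMeasure) :
    E.tilde f ≤ E.tildeOn (Ioo 0 u) f + E.tildeOn (Ioi u) f := by
  rw [← tildeOn_univ]
  refine E.tildeOn_le_add measurableSet_Ioo measurableSet_Ioi ?_ hf
  filter_upwards [ae_homMeasure_pos, ae_homMeasure_ne u] with x hx hxu _
  rcases hxu.lt_or_gt with h | h
  · exact Or.inl ⟨hx, h⟩
  · exact Or.inr h

theorem tildeOn_Ioo_le_add (u t : ℝ) {f : ℝ → ℝ≥0∞} (hf : AEMeasurable f homMeasure) :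
    E.tildeOn (Ioo 0 t) f ≤ E.tildeOn (Ioo 0 u) f + E.tildeOn (Ioo u t) f := by
  refine E.tildeOn_le_add measurableSet_Ioo measurableSet_Ioo ?_ hf
  filter_upwards [ae_homMeasure_ne u] with x hxu hx
  rcases hxu.lt_or_gt with h | h
  · exact Or.inl ⟨hx.1, h⟩
  · exact Or.inr ⟨h, hx.2⟩

theorem tildeOn_comp {T : ℝ → ℝ} (hT : MeasurePreserving T homMeasure homMeasure) {I : Set ℝ}
    (hI : MeasurableSet I) {f : ℝ → ℝ≥0∞} (hf : AEMeasurable f homMeasure) :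
    E.tildeOn (T ⁻¹' I) (f ∘ T) = E.tildeOn I f := by
  rw [tildeOn, tildeOn, ← E.tilde_comp hT (hf.indicator hI)]
  exact congrArg E.tilde (funext fun x => indicator_comp_right T)

end RISpace

/-! ### Powers -/

/-- The power function `t ↦ t^α`, with extended non-negative values. -/
def pw (α t : ℝ) : ℝ≥0∞ := ENNReal.ofReal (t ^ α)

theorem pw_ne_top (α t : ℝ) : pw α t ≠ ∞ := ENNReal.ofReal_ne_top

theorem pw_ne_zero (α : ℝ) {t : ℝ} (ht : 0 < t) : pw α t ≠ 0 :=
  (ENNReal.ofReal_pos.2 (Real.rpow_pos_of_pos ht α)).ne'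

theorem pw_add (α β : ℝ) {t : ℝ} (ht : 0 < t) : pw (α + β) t = pw α t * pw β t := by
  rw [pw, pw, pw, ← ENNReal.ofReal_mul (Real.rpow_pos_of_pos ht α).le, Real.rpow_add ht]

theorem pw_one (t : ℝ) : pw 1 t = ENNReal.ofReal t := by
  rw [pw, Real.rpow_one]

theorem pw_zero (t : ℝ) : pw 0 t = 1 := by
  rw [pw, Real.rpow_zero, ENNReal.ofReal_one]

theorem pw_inv (α : ℝ) {t : ℝ} (ht : 0 < t) : pw α t⁻¹ = pw (-α) t := by
  rw [pw, pw, Real.inv_rpow ht.le, Real.rpow_neg ht.le]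

theorem pw_div (α : ℝ) {s t : ℝ} (hs : 0 < s) (ht : 0 < t) :
    pw α (t / s) * pw α s = pw α t := by
  rw [pw, pw, pw, ← ENNReal.ofReal_mul (by positivity), ← Real.mul_rpow (by positivity) hs.le,
    div_mul_cancel₀ _ hs.ne']

theorem pw_le_pw {α β t : ℝ} (ht : 1 ≤ t) (h : α ≤ β) : pw α t ≤ pw β t :=
  ENNReal.ofReal_le_ofReal (Real.rpow_le_rpow_of_exponent_le ht h)

theorem pw_mono {α s t : ℝ} (hs : 0 ≤ s) (hst : s ≤ t) (hα : 0 ≤ α) : pw α s ≤ pw α t :=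
  ENNReal.ofReal_le_ofReal (Real.rpow_le_rpow hs hst hα)

theorem one_le_pw {α t : ℝ} (ht : 1 ≤ t) (h : 0 ≤ α) : 1 ≤ pw α t := by
  rw [← pw_zero t]
  exact pw_le_pw ht h

theorem measurable_pw (α : ℝ) : Measurable (pw α) := by
  unfold pw
  fun_prop

/-! ### Regularly varying functions -/

/-- `w` is equivalent to a power `t^α` times a slowly varying function. -/
structure RegVar (α : ℝ) (w : ℝ → ℝ≥0∞) : Prop where
  ne_zero : ∀ t, 0 < t → w t ≠ 0
  ne_top : ∀ t, 0 < t → w t ≠ ∞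
  aemeasurable : AEMeasurable w homMeasure
  bound : ∀ ε : ℝ, 0 < ε → ∃ C : ℝ≥0, ∀ s t, 0 < s → s ≤ t →
    w s ≤ C * pw (ε - α) (t / s) * w t ∧ w t ≤ C * pw (ε + α) (t / s) * w s

theorem SlowlyVarying.regVar {b : ℝ → ℝ} (hb : SlowlyVarying b) : RegVar 0 (ennFun b) where
  ne_zero t ht := (ENNReal.ofReal_pos.2 (hb.pos t ht)).ne'
  ne_top _ _ := ENNReal.ofReal_ne_top
  aemeasurable := (hb.aemeasurable.mono_ac homMeasure_absolutelyContinuous).ennreal_ofReal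
  bound ε hε := by
    obtain ⟨g, hg, c, C, hc, hC, hgb⟩ := hb.equiv_monotone ε hε
    obtain ⟨h, hh, c', C', hc', hC', hhb⟩ := hb.equiv_antitone ε hε
    -- Transfers a real bound to extended values, with one constant serving both directions.
    have key : ∀ {x y D p : ℝ}, 0 < p → D ≤ max (C / c) (C' / c') → 0 < y → x ≤ D * p * y →
        ENNReal.ofReal x ≤ (max (C / c) (C' / c')).toNNReal * ENNReal.ofReal p *
          ENNReal.ofReal y := by
      intro x y D p hp hD hy hxy
      have h0 : 0 ≤ max (C / c) (C' / c') := le_max_of_le_left (by positivity)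
      change _ ≤ ENNReal.ofReal _ * _ * _
      rw [← ENNReal.ofReal_mul h0, ← ENNReal.ofReal_mul (by positivity)]
      exact ENNReal.ofReal_le_ofReal (hxy.trans (by gcongr))
    refine ⟨(max (C / c) (C' / c')).toNNReal, fun s t hs hst => ?_⟩
    have ht := hs.trans_le hst
    have hp : 0 < (t / s) ^ ε := Real.rpow_pos_of_pos (by positivity) ε
    simp only [sub_zero, add_zero]
    refine ⟨key hp (le_max_left _ _) (hb.pos t ht) ?_, key hp (le_max_right _ _) (hb.pos s hs) ?_⟩
    · have h1 : s ^ ε * b s ≤ C * g t :=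
        (hgb s hs).2.trans (mul_le_mul_of_nonneg_left (hg hs ht hst) hC.le)
      have h2 : g t ≤ t ^ ε * b t / c := by
        rw [le_div_iff₀ hc, mul_comm]
        exact (hgb t ht).1
      have h3 : s ^ ε * b s ≤ C * (t ^ ε * b t / c) := h1.trans (by gcongr)
      have hsp : 0 < s ^ ε := Real.rpow_pos_of_pos hs ε
      rw [Real.div_rpow ht.le hs.le]
      calc b s = (s ^ ε * b s) / s ^ ε := by field_simp
        _ ≤ (C * (t ^ ε * b t / c)) / s ^ ε := by gcongr
        _ = _ := by field_simp
    · have h1 : t ^ (-ε) * b t ≤ C' * h s :=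
        (hhb t ht).2.trans (mul_le_mul_of_nonneg_left (hh hs ht hst) hC'.le)
      have h2 : h s ≤ s ^ (-ε) * b s / c' := by
        rw [le_div_iff₀ hc', mul_comm]
        exact (hhb s hs).1
      have h3 : t ^ (-ε) * b t ≤ C' * (s ^ (-ε) * b s / c') := h1.trans (by gcongr)
      have hsp : 0 < s ^ ε := Real.rpow_pos_of_pos hs ε
      have htp : 0 < t ^ ε := Real.rpow_pos_of_pos ht ε
      rw [Real.rpow_neg ht.le, Real.rpow_neg hs.le] at h3
      rw [Real.div_rpow ht.le hs.le]
      calc b t = t ^ ε * ((t ^ ε)⁻¹ * b t) := by field_simp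
        _ ≤ t ^ ε * (C' * ((s ^ ε)⁻¹ * b s / c')) := by gcongr
        _ = _ := by field_simp

namespace RegVar

theorem congr {α β : ℝ} {v w : ℝ → ℝ≥0∞} (hw : RegVar α w) (hα : α = β) (h : w = v) :
    RegVar β v := hα ▸ h ▸ hw

theorem pw (α : ℝ) : RegVar α (pw α) where
  ne_zero _ ht := pw_ne_zero α ht
  ne_top _ _ := pw_ne_top _ _
  aemeasurable := (measurable_pw α).aemeasurable
  bound ε hε := by
    refine ⟨1, fun s t hs hst => ?_⟩
    have ht := hs.trans_le hst
    have h1 : 1 ≤ t / s := (one_le_div hs).2 hst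
    rw [ENNReal.coe_one, one_mul, one_mul]
    constructor
    · calc Holmstedt.pw α s = Holmstedt.pw (-α) (t / s) * Holmstedt.pw α t := by
            rw [← pw_inv α (by positivity), inv_div, pw_div α ht hs]
        _ ≤ _ := by
            gcongr
            exact pw_le_pw h1 (by linarith)
    · rw [← pw_div α hs ht]
      gcongr
      exact pw_le_pw h1 (by linarith)

theorem mul {α β : ℝ} {v w : ℝ → ℝ≥0∞} (hv : RegVar α v) (hw : RegVar β w) :
    RegVar (α + β) fun t => v t * w t where
  ne_zero t ht := mul_ne_zero (hv.ne_zero t ht) (hw.ne_zero t ht)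
  ne_top t ht := ENNReal.mul_ne_top (hv.ne_top t ht) (hw.ne_top t ht)
  aemeasurable := hv.aemeasurable.mul hw.aemeasurable
  bound ε hε := by
    obtain ⟨C, hC⟩ := hv.bound (ε / 2) (by positivity)
    obtain ⟨D, hD⟩ := hw.bound (ε / 2) (by positivity)
    refine ⟨C * D, fun s t hs hst => ?_⟩
    have h0 : 0 < t / s := div_pos (hs.trans_le hst) hs
    constructor
    · refine (mul_le_mul' (hC s t hs hst).1 (hD s t hs hst).1).trans_eq ?_
      rw [show ε - (α + β) = (ε / 2 - α) + (ε / 2 - β) by ring, pw_add (ε / 2 - α) (ε / 2 - β) h0,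
        ENNReal.coe_mul]
      ring
    · refine (mul_le_mul' (hC s t hs hst).2 (hD s t hs hst).2).trans_eq ?_
      rw [show ε + (α + β) = (ε / 2 + α) + (ε / 2 + β) by ring, pw_add (ε / 2 + α) (ε / 2 + β) h0,
        ENNReal.coe_mul]
      ring

/-- Inversion exchanges the two halves of `bound`. -/
theorem inv {α : ℝ} {w : ℝ → ℝ≥0∞} (hw : RegVar α w) : RegVar (-α) fun t => (w t)⁻¹ where
  ne_zero t ht := ENNReal.inv_ne_zero.2 (hw.ne_top t ht)
  ne_top t ht := ENNReal.inv_ne_top.2 (hw.ne_zero t ht)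
  aemeasurable := hw.aemeasurable.inv
  bound ε hε := by
    have key : ∀ {x y M : ℝ≥0∞}, x ≠ 0 → x ≠ ∞ → y ≠ 0 → y ≠ ∞ → x ≤ M * y →
        y⁻¹ ≤ M * x⁻¹ := by
      intro x y M hx hx' hy hy' h
      calc y⁻¹ = y⁻¹ * (x * x⁻¹) := by rw [ENNReal.mul_inv_cancel hx hx', mul_one]
        _ ≤ y⁻¹ * (M * y * x⁻¹) := by gcongr
        _ = (y * y⁻¹) * (M * x⁻¹) := by ring
        _ = _ := by rw [ENNReal.mul_inv_cancel hy hy', one_mul]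
    obtain ⟨C, hC⟩ := hw.bound ε hε
    refine ⟨C, fun s t hs hst => ?_⟩
    have ht := hs.trans_le hst
    rw [sub_neg_eq_add, ← sub_eq_add_neg]
    exact ⟨key (hw.ne_zero t ht) (hw.ne_top t ht) (hw.ne_zero s hs) (hw.ne_top s hs)
        (hC s t hs hst).2,
      key (hw.ne_zero s hs) (hw.ne_top s hs) (hw.ne_zero t ht) (hw.ne_top t ht) (hC s t hs hst).1⟩

end RegVar

/-! ### Norms of powers and of characteristic functions -/

namespace RISpace

variable (E : RISpace)

/-- The norm of the characteristic function of an interval of unit `dt/t` measure. -/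
def unitNorm : ℝ≥0∞ := E.tildeOn (Ioc (Real.exp (-1)) 1) fun _ => 1

theorem homMeasure_Ioc_exp : homMeasure (Ioc (Real.exp (-1)) 1) = 1 := by
  rw [← measurePreserving_exp.measure_preimage measurableSet_Ioc.nullMeasurableSet]
  have : Real.exp ⁻¹' Ioc (Real.exp (-1)) 1 = Ioc (-1) 0 := by
    ext x
    simp only [mem_preimage, mem_Ioc, Real.exp_lt_exp, Real.exp_le_one_iff]
  rw [this]
  simp

theorem unitNorm_ne_zero : E.unitNorm ≠ 0 :=
  E.tilde_ne_zero measurableSet_Ioc (by simp [homMeasure_Ioc_exp])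

theorem unitNorm_ne_top : E.unitNorm ≠ ∞ :=
  (E.tilde_indicator_lt_top measurableSet_Ioc (by simp [homMeasure_Ioc_exp])).ne

theorem tildeOn_Ioc_exp {t : ℝ} (ht : 0 < t) :
    E.tildeOn (Ioc (t * Real.exp (-1)) t) (fun _ => 1) = E.unitNorm := by
  rw [unitNorm, ← E.tildeOn_comp (I := Ioc (Real.exp (-1)) 1)
    (measurePreserving_mul_left (inv_pos.2 ht)) measurableSet_Ioc aemeasurable_const]
  congr 1
  ext x
  simp only [mem_preimage, mem_Ioc]
  rw [lt_inv_mul_iff₀ ht, inv_mul_le_iff₀ ht, mul_one]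

/-- Cut `(0,1)` into the intervals `(e^{-n-1}, e^{-n}]` of unit measure. On the `n`-th the power is
at most `e^{-βn}`, and countable subadditivity leaves a geometric series times `unitNorm`. -/
theorem tildeOn_pw_ne_top {β : ℝ} (hβ : 0 < β) : E.tildeOn (Ioo 0 1) (pw β) ≠ ∞ := by
  set I : ℕ → Set ℝ := fun n => Ioc (Real.exp (-n) * Real.exp (-1)) (Real.exp (-n))
  set q := ENNReal.ofReal (Real.exp (-β))
  have hq : q < 1 := by
    rw [← ENNReal.ofReal_one]
    exact (ENNReal.ofReal_lt_ofReal_iff one_pos).2 (by simpa using hβ)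
  have hmeas : ∀ n, AEMeasurable (fun x => q ^ n * (I n).indicator (fun _ => 1) x) homMeasure :=
    fun n => (aemeasurable_const.indicator measurableSet_Ioc).const_mul _
  have hle : E.tildeOn (Ioo 0 1) (pw β)
      ≤ E.tilde fun x => ∑' n, q ^ n * (I n).indicator (fun _ => 1) x := by
    refine E.tilde_mono (Eventually.of_forall fun x => ?_)
    by_cases hx : x ∈ Ioo 0 1
    · rw [indicator_of_mem hx]
      have hlog : 0 ≤ -Real.log x := by simpa using Real.log_nonpos hx.1.le hx.2.le
      set n := ⌊-Real.log x⌋₊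
      have h1 : (n : ℝ) ≤ -Real.log x := Nat.floor_le hlog
      have h2 : -Real.log x < n + 1 := Nat.lt_floor_add_one _
      have hxn : x ≤ Real.exp (-n) := by
        rw [← Real.log_le_iff_le_exp hx.1]
        linarith
      have hmem : x ∈ I n := by
        refine ⟨?_, hxn⟩
        rw [← Real.exp_add, ← Real.lt_log_iff_exp_lt hx.1]
        linarith
      refine le_trans ?_ (ENNReal.le_tsum n)
      rw [indicator_of_mem hmem, mul_one]
      refine (pw_mono hx.1.le hxn hβ.le).trans_eq ?_
      rw [pw, ← ENNReal.ofReal_pow (Real.exp_pos _).le, ← Real.exp_mul, ← Real.exp_nat_mul]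
      congr 2
      ring
    · rw [indicator_of_notMem hx]
      exact zero_le
  refine ne_top_of_le_ne_top ?_ (hle.trans (E.tilde_tsum_le hmeas))
  have : ∀ n, E.tilde (fun x => q ^ n * (I n).indicator (fun _ => 1) x) = q ^ n * E.unitNorm := by
    intro n
    rw [E.tilde_const_mul _ (aemeasurable_const.indicator measurableSet_Ioc),
      ← E.tildeOn_Ioc_exp (Real.exp_pos (-n))]
    rfl
  simp_rw [this]
  rw [ENNReal.tsum_mul_right, ENNReal.tsum_geometric]
  exact ENNReal.mul_ne_top (ENNReal.inv_ne_top.2 (tsub_pos_of_lt hq).ne') E.unitNorm_ne_top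

end RISpace

/-! ### Norms of regularly varying functions -/

namespace RegVar

/-- With `ε = α/2`, `bound` gives `w(s) ≤ C (s/t)^{α/2} w(t)` for `s < t`; dilation by `t` reduces
the norm of the power to `(0,1)`. -/
theorem tildeOn_Ioo_le {α : ℝ} (hα : 0 < α) {w : ℝ → ℝ≥0∞} (hw : RegVar α w) (E : RISpace) :
    ∃ C : ℝ≥0, ∀ t, 0 < t → E.tildeOn (Ioo 0 t) w ≤ C * w t := by
  obtain ⟨C, hC⟩ := hw.bound (α / 2) (by positivity)
  have hD := E.tildeOn_pw_ne_top (half_pos hα)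
  refine ⟨C * (E.tildeOn (Ioo 0 1) (Holmstedt.pw (α / 2))).toNNReal, fun t ht => ?_⟩
  rw [ENNReal.coe_mul, ENNReal.coe_toNNReal hD]
  have hT := measurePreserving_mul_left (inv_pos.2 ht)
  have hm : AEMeasurable (Holmstedt.pw (α / 2)) homMeasure := (measurable_pw _).aemeasurable
  have hpre : (fun x => t⁻¹ * x) ⁻¹' Ioo 0 1 = Ioo 0 t := by
    ext x
    simp only [mem_preimage, mem_Ioo]
    rw [lt_inv_mul_iff₀ ht, inv_mul_lt_iff₀ ht, mul_one, mul_zero]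
  rw [← E.tildeOn_comp hT measurableSet_Ioo hm, hpre, mul_right_comm]
  refine E.tildeOn_le_const_mul measurableSet_Ioo
    (hm.comp_quasiMeasurePreserving hT.quasiMeasurePreserving) fun s hs => ?_
  refine (hC s t hs.1 hs.2.le).1.trans_eq ?_
  rw [show α / 2 - α = -(α / 2) by ring, ← pw_inv _ (div_pos ht hs.1), inv_div,
    Function.comp_apply, div_eq_inv_mul]
  ring_nf

/-- As on `(0,t)`, with `s ↦ t/s` carrying `(t,∞)` to `(0,1)`. -/
theorem tildeOn_Ioi_le {α : ℝ} (hα : α < 0) {w : ℝ → ℝ≥0∞} (hw : RegVar α w) (E : RISpace) :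
    ∃ C : ℝ≥0, ∀ t, 0 < t → E.tildeOn (Ioi t) w ≤ C * w t := by
  obtain ⟨C, hC⟩ := hw.bound (-α / 2) (by linarith)
  have hD := E.tildeOn_pw_ne_top (β := -α / 2) (by linarith)
  refine ⟨C * (E.tildeOn (Ioo 0 1) (Holmstedt.pw (-α / 2))).toNNReal, fun t ht => ?_⟩
  rw [ENNReal.coe_mul, ENNReal.coe_toNNReal hD]
  have hT := (measurePreserving_mul_left ht).comp measurePreserving_inv
  have hm : AEMeasurable (Holmstedt.pw (-α / 2)) homMeasure := (measurable_pw _).aemeasurable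
  have hpre : ((fun x => t * x) ∘ fun x => x⁻¹) ⁻¹' Ioo 0 1 = Ioi t := by
    ext x
    simp only [mem_preimage, mem_Ioo, mem_Ioi, Function.comp_apply, ← div_eq_mul_inv]
    constructor
    · rintro ⟨h1, h2⟩
      exact (div_lt_one ((div_pos_iff_of_pos_left ht).1 h1)).1 h2
    · intro h
      exact ⟨div_pos ht (ht.trans h), (div_lt_one (ht.trans h)).2 h⟩
  rw [← E.tildeOn_comp hT measurableSet_Ioo hm, hpre, mul_right_comm]
  refine E.tildeOn_le_const_mul measurableSet_Ioi
    (hm.comp_quasiMeasurePreserving hT.quasiMeasurePreserving) fun s hs => ?_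
  have hs0 : 0 < s := ht.trans hs
  refine (hC t s ht (le_of_lt hs)).2.trans_eq ?_
  rw [show -α / 2 + α = -(-α / 2) by ring, ← pw_inv _ (div_pos hs0 ht), inv_div,
    Function.comp_apply, Function.comp_apply, div_eq_mul_inv]
  ring_nf

/-- The interval has norm `unitNorm` whatever `r` is, so a pointwise bound on it becomes a norm
bound with a uniform constant. -/
theorem le_of_forall_mem_Ioc {w : ℝ → ℝ≥0∞} (hw : AEMeasurable w homMeasure) (E : RISpace)
    {I : Set ℝ} {r : ℝ} (hr : 0 < r) (hI : Ioc (r * Real.exp (-1)) r ⊆ I) {M x : ℝ≥0∞}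
    (h : ∀ s ∈ Ioc (r * Real.exp (-1)) r, x ≤ M * w s) :
    x ≤ M * E.unitNorm⁻¹ * E.tildeOn I w := by
  have h1 : x * E.unitNorm ≤ M * E.tildeOn I w := by
    rw [← E.tildeOn_Ioc_exp hr, ← E.tildeOn_const_mul measurableSet_Ioc _ aemeasurable_const]
    refine (E.tildeOn_le_const_mul measurableSet_Ioc hw fun s hs => ?_).trans
      (mul_le_mul_right (E.tildeOn_mono hI fun _ _ => le_rfl) M)
    rw [mul_one]
    exact h s hs
  rw [mul_right_comm, ← div_eq_mul_inv]
  exact (ENNReal.le_div_iff_mul_le (.inl E.unitNorm_ne_zero) (.inl E.unitNorm_ne_top)).2 h1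

theorem le_tildeOn_Ioi {α : ℝ} {w : ℝ → ℝ≥0∞} (hw : RegVar α w) (E : RISpace) :
    ∃ C : ℝ≥0, ∀ t, 0 < t → w t ≤ C * E.tildeOn (Ioi t) w := by
  obtain ⟨C, hC⟩ := hw.bound 1 one_pos
  have he : 1 < Real.exp 1 := by simp
  refine ⟨C * (Holmstedt.pw |1 - α| (Real.exp 1)).toNNReal * E.unitNorm⁻¹.toNNReal,
    fun t ht => ?_⟩
  rw [ENNReal.coe_mul, ENNReal.coe_mul, ENNReal.coe_toNNReal (pw_ne_top _ _),
    ENNReal.coe_toNNReal (ENNReal.inv_ne_top.2 E.unitNorm_ne_zero)]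
  have ht' : t * Real.exp 1 * Real.exp (-1) = t := by
    rw [mul_assoc, ← Real.exp_add]; simp
  refine le_of_forall_mem_Ioc hw.aemeasurable E (r := t * Real.exp 1) (by positivity) ?_
    fun s hs => ?_
  · rw [ht']
    exact fun s hs => hs.1
  · rw [ht'] at hs
    refine (hC t s ht hs.1.le).1.trans ?_
    gcongr
    -- The exponent `1 - α` may have either sign; its absolute value allows evaluation at the
    -- largest ratio `e`.
    refine (pw_le_pw ((one_le_div ht).2 hs.1.le) (le_abs_self _)).trans
      (pw_mono (div_nonneg (ht.trans hs.1).le ht.le) ?_ (abs_nonneg _))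
    rw [div_le_iff₀ ht, mul_comm]
    exact hs.2

theorem le_tildeOn_Ioo {α : ℝ} {w : ℝ → ℝ≥0∞} (hw : RegVar α w) (E : RISpace) :
    ∃ C : ℝ≥0, ∀ t, 0 < t → w t ≤ C * E.tildeOn (Ioo 0 t) w := by
  obtain ⟨C, hC⟩ := hw.bound 1 one_pos
  have he : Real.exp (-1) < 1 := by simp
  have he0 := Real.exp_pos (-1)
  refine ⟨C * (Holmstedt.pw |1 + α| (Real.exp (-1) * Real.exp (-1))⁻¹).toNNReal *
    E.unitNorm⁻¹.toNNReal, fun t ht => ?_⟩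
  rw [ENNReal.coe_mul, ENNReal.coe_mul, ENNReal.coe_toNNReal (pw_ne_top _ _),
    ENNReal.coe_toNNReal (ENNReal.inv_ne_top.2 E.unitNorm_ne_zero)]
  have hlt : t * Real.exp (-1) < t := by nlinarith
  -- With `r = t` the right endpoint would fall outside `(0,t)`; one more factor `e⁻¹` keeps the
  -- interval inside, with ratios up to `e²`.
  refine le_of_forall_mem_Ioc hw.aemeasurable E (r := t * Real.exp (-1)) (by positivity) ?_
    fun s hs => ?_
  · exact fun s hs => ⟨lt_trans (by positivity) hs.1, hs.2.trans_lt hlt⟩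
  · have hs0 : 0 < s := lt_trans (by positivity) hs.1
    have hst : s ≤ t := hs.2.trans hlt.le
    refine (hC s t hs0 hst).2.trans ?_
    gcongr
    refine (pw_le_pw ((one_le_div hs0).2 hst) (le_abs_self _)).trans
      (pw_mono (div_nonneg ht.le hs0.le) ?_ (abs_nonneg _))
    rw [div_le_iff₀ hs0, ← div_eq_inv_mul, le_div_iff₀ (by positivity), ← mul_assoc]
    exact hs.1.le

/-- One bound is monotonicity. For the other, `x ↦ (t/s)x` carries `(s,∞)` onto `(t,∞)` and changes
`b` by at most `C (t/s)^ε`; this also spreads finiteness from `1` to all of `(0,∞)`. -/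
theorem tail {b : ℝ → ℝ≥0∞} (hb : RegVar 0 b) (E : RISpace) (h : E.tildeOn (Ioi 1) b < ∞) :
    RegVar 0 fun t => E.tildeOn (Ioi t) b := by
  have hanti : Antitone fun t => E.tildeOn (Ioi t) b := fun s t hst =>
    E.tildeOn_mono (Ioi_subset_Ioi hst) fun _ _ => le_rfl
  have hbound : ∀ ε : ℝ, 0 < ε → ∃ C : ℝ≥0, ∀ s t, 0 < s → s ≤ t →
      E.tildeOn (Ioi s) b ≤ C * Holmstedt.pw ε (t / s) * E.tildeOn (Ioi t) b := by
    intro ε hε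
    obtain ⟨C, hC⟩ := hb.bound ε hε
    refine ⟨C, fun s t hs hst => ?_⟩
    have hts : 0 < t / s := div_pos (hs.trans_le hst) hs
    have h1 : 1 ≤ t / s := (one_le_div hs).2 hst
    have hT := measurePreserving_mul_left hts
    have hpre : (fun x => t / s * x) ⁻¹' Ioi t = Ioi s := by
      ext x
      have ht : 0 < t := hs.trans_le hst
      simp only [mem_preimage, mem_Ioi]
      rw [div_mul_eq_mul_div, lt_div_iff₀ hs, mul_lt_mul_iff_right₀ ht]
    rw [← E.tildeOn_comp (I := Ioi t) hT measurableSet_Ioi hb.aemeasurable, hpre]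
    refine E.tildeOn_le_const_mul measurableSet_Ioi
      (hb.aemeasurable.comp_quasiMeasurePreserving hT.quasiMeasurePreserving) fun x hx => ?_
    have hx0 : 0 < x := hs.trans hx
    have := (hC x (t / s * x) hx0 (le_mul_of_one_le_left hx0.le h1)).1
    rwa [sub_zero, mul_div_assoc, div_self hx0.ne', mul_one] at this
  refine ⟨fun t ht h0 => ?_, fun t ht => ?_, hanti.measurable.aemeasurable, fun ε hε => ?_⟩
  · obtain ⟨C, hC⟩ := hb.le_tildeOn_Ioi E
    have := hC t ht
    rw [h0, mul_zero] at this
    exact hb.ne_zero t ht (nonpos_iff_eq_zero.1 this)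
  · rcases le_total 1 t with h1 | h1
    · exact ((hanti h1).trans_lt h).ne
    · obtain ⟨C, hC⟩ := hbound 1 one_pos
      exact ne_top_of_le_ne_top
        (ENNReal.mul_ne_top (ENNReal.mul_ne_top ENNReal.coe_ne_top (pw_ne_top _ _)) h.ne)
        (hC t 1 ht h1)
  · obtain ⟨C, hC⟩ := hbound ε hε
    refine ⟨max C 1, fun s t hs hst => ⟨?_, ?_⟩⟩
    · rw [sub_zero]
      refine (hC s t hs hst).trans ?_
      gcongr
      exact le_max_left _ _
    · rw [add_zero]
      refine (hanti hst).trans (le_mul_of_one_le_left' ?_)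
      refine one_le_mul ?_ (one_le_pw ((one_le_div hs).2 hst) hε.le)
      exact_mod_cast le_max_right _ _

end RegVar

/-! ### Quasi-concave functions -/

/-- Quasi-concave functions on `(0,∞)`: `k` is non-decreasing and `k(t)/t` is non-increasing. -/
structure QuasiConcave (k : ℝ → ℝ≥0∞) : Prop where
  mono : Monotone k
  mul_le : ∀ s t, 0 < s → s ≤ t → pw 1 s * k t ≤ pw 1 t * k s

theorem pw_one_mul_neg_one {t : ℝ} (ht : 0 < t) : pw 1 t * pw (-1) t = 1 := by
  rw [← pw_add _ _ ht, add_neg_cancel, pw_zero]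

namespace QuasiConcave

variable {k : ℝ → ℝ≥0∞}

theorem aemeasurable (hk : QuasiConcave k) : AEMeasurable k homMeasure :=
  hk.mono.measurable.aemeasurable

theorem mul_pw_le (hk : QuasiConcave k) {s t : ℝ} (hs : 0 < s) (hst : s ≤ t) :
    pw 1 s * pw (-1) t * k t ≤ k s := by
  calc pw 1 s * pw (-1) t * k t = pw (-1) t * (pw 1 s * k t) := by ring
    _ ≤ pw (-1) t * (pw 1 t * k s) := mul_le_mul_right (hk.mul_le s t hs hst) _
    _ = pw 1 t * pw (-1) t * k s := by ring
    _ = k s := by rw [pw_one_mul_neg_one (hs.trans_le hst), one_mul]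

end QuasiConcave

theorem RISpace.monotone_tildeOn_Ioo (E : RISpace) (u : ℝ) (f : ℝ → ℝ≥0∞) :
    Monotone fun t => E.tildeOn (Ioo u t) f :=
  fun _ _ hst => E.tildeOn_mono (Ioo_subset_Ioo_right hst) fun _ _ => le_rfl

/-! ### A single interpolation space -/

/-- The parameters of a space `(X₀, X₁)^𝓛_{θ,b,E,a,F}`, with weight `v(s) = s^{-θ} a(s)`. -/
structure LSpace where
  θ : ℝ
  v : ℝ → ℝ≥0∞
  b : ℝ → ℝ≥0∞
  E : RISpace
  F : RISpace
  pos : 0 < θ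
  lt_one : θ < 1
  regVar_v : RegVar (-θ) v
  regVar_b : RegVar 0 b
  tail_lt_top : E.tildeOn (Ioi 1) b < ∞

namespace LSpace

variable (S : LSpace)

/-- The inner norm `‖v k‖_{F̃(0,t)}`. -/
def inner (k : ℝ → ℝ≥0∞) (t : ℝ) : ℝ≥0∞ := S.F.tildeOn (Ioo 0 t) fun s => S.v s * k s

/-- The norm `‖b‖_{Ẽ(t,∞)}`. -/
def tail (t : ℝ) : ℝ≥0∞ := S.E.tildeOn (Ioi t) S.b

/-- The norm of an element with K-functional `k`. -/
def total (k : ℝ → ℝ≥0∞) : ℝ≥0∞ := S.E.tilde fun t => S.b t * S.inner k t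

theorem regVar_tail : RegVar 0 S.tail := S.regVar_b.tail S.E S.tail_lt_top

theorem regVar_v_mul_tail : RegVar (-S.θ) fun t => S.v t * S.tail t :=
  (S.regVar_v.mul S.regVar_tail).congr (add_zero _) rfl

theorem inner_mono (k : ℝ → ℝ≥0∞) : Monotone (S.inner k) := S.F.monotone_tildeOn_Ioo 0 _

theorem aemeasurable_b_mul {g : ℝ → ℝ≥0∞} (hg : Monotone g) :
    AEMeasurable (fun t => S.b t * g t) homMeasure :=
  S.regVar_b.aemeasurable.mul hg.measurable.aemeasurable

theorem aemeasurable_v_mul {k : ℝ → ℝ≥0∞} (hk : QuasiConcave k) :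
    AEMeasurable (fun t => S.v t * k t) homMeasure :=
  S.regVar_v.aemeasurable.mul hk.aemeasurable

theorem b_le_tail : ∃ C : ℝ≥0, ∀ t, 0 < t → S.b t ≤ C * S.tail t :=
  S.regVar_b.le_tildeOn_Ioi S.E

/-- On `(0,t)` one has `k(s) ≥ (s/t) k(t)`, so the inner norm is at least `k(t)/t` times the norm of
`s v(s)`, which dominates `t v(t)`. -/
theorem v_mul_le_inner : ∃ C : ℝ≥0, ∀ k, QuasiConcave k → ∀ t, 0 < t →
    S.v t * k t ≤ C * S.inner k t := by
  have hreg := (RegVar.pw 1).mul S.regVar_v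
  obtain ⟨C, hC⟩ := hreg.le_tildeOn_Ioo S.F
  refine ⟨C, fun k hk t ht => ?_⟩
  calc S.v t * k t = pw (-1) t * k t * (pw 1 t * S.v t) := by
        rw [← one_mul (S.v t * k t), ← pw_one_mul_neg_one ht]
        ring
    _ ≤ pw (-1) t * k t * (C * S.F.tildeOn (Ioo 0 t) fun s => pw 1 s * S.v s) :=
        mul_le_mul_right (hC t ht) _
    _ = C * S.F.tildeOn (Ioo 0 t) fun s => pw (-1) t * k t * (pw 1 s * S.v s) := by
        rw [S.F.tildeOn_const_mul measurableSet_Ioo _ hreg.aemeasurable]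
        ring
    _ ≤ _ := by
        refine mul_le_mul_right (S.F.tildeOn_mono subset_rfl fun s hs => ?_) _
        calc pw (-1) t * k t * (pw 1 s * S.v s) = S.v s * (pw 1 s * pw (-1) t * k t) := by ring
          _ ≤ S.v s * k s := by gcongr; exact hk.mul_pw_le hs.1 hs.2.le

theorem tail_mul_inner_le_tildeOn (k : ℝ → ℝ≥0∞) (t : ℝ) :
    S.tail t * S.inner k t ≤ S.E.tildeOn (Ioi t) fun s => S.b s * S.inner k s := by
  rw [tail, mul_comm, ← S.E.tildeOn_const_mul measurableSet_Ioi _ S.regVar_b.aemeasurable]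
  refine S.E.tildeOn_mono subset_rfl fun s hs => ?_
  rw [mul_comm]
  gcongr
  exact S.inner_mono k (le_of_lt hs)

theorem tail_mul_inner_le_total (k : ℝ → ℝ≥0∞) (t : ℝ) :
    S.tail t * S.inner k t ≤ S.total k :=
  (S.tail_mul_inner_le_tildeOn k t).trans (S.E.tildeOn_le_tilde _ _)

/-- `v k` is dominated by the inner norm, which is non-decreasing and so can be frozen at `t` in the
outer norm over `(t,∞)`. -/
theorem le_total : ∃ C : ℝ≥0, ∀ k, QuasiConcave k → ∀ t, 0 < t →
    k t ≤ C * S.total k * (S.v t * S.tail t)⁻¹ := by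
  obtain ⟨C, hC⟩ := S.v_mul_le_inner
  refine ⟨C, fun k hk t ht => ?_⟩
  have hreg := S.regVar_v_mul_tail
  rw [← div_eq_mul_inv, ENNReal.le_div_iff_mul_le (.inl (hreg.ne_zero t ht))
    (.inl (hreg.ne_top t ht))]
  calc k t * (S.v t * S.tail t) = S.tail t * (S.v t * k t) := by ring
    _ ≤ S.tail t * (C * S.inner k t) := mul_le_mul_right (hC k hk t ht) _
    _ = C * (S.tail t * S.inner k t) := by ring
    _ ≤ _ := by gcongr; exact S.tail_mul_inner_le_total k t

end LSpace

/-! ### Two interpolation spaces -/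

/-- The parameters of a couple of spaces `(X₀, X₁)^𝓛`. -/
structure LCouple where
  fst : LSpace
  snd : LSpace
  lt : fst.θ < snd.θ

namespace LCouple

variable (D : LCouple)

/-- `ρ = v₀ ‖b₀‖_{Ẽ₀(·,∞)} / (v₁ ‖b₁‖_{Ẽ₁(·,∞)})`. -/
def ratio (u : ℝ) : ℝ≥0∞ := D.fst.v u * D.fst.tail u * (D.snd.v u * D.snd.tail u)⁻¹

theorem regVar_ratio : RegVar (D.snd.θ - D.fst.θ) D.ratio :=
  (D.fst.regVar_v_mul_tail.mul D.snd.regVar_v_mul_tail.inv).congr (by ring) rfl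

/-- `‖b₀ ‖v₀ k‖_{F̃₀(0,·)}‖_{Ẽ₀(0,u)}`. -/
def head (k : ℝ → ℝ≥0∞) (u : ℝ) : ℝ≥0∞ :=
  D.fst.E.tildeOn (Ioo 0 u) fun t => D.fst.b t * D.fst.inner k t

/-- `‖b₁ ‖v₁ k‖_{F̃₁(u,·)}‖_{Ẽ₁(u,∞)}`. -/
def rest (k : ℝ → ℝ≥0∞) (u : ℝ) : ℝ≥0∞ :=
  D.snd.E.tildeOn (Ioi u) fun t => D.snd.b t * D.snd.F.tildeOn (Ioo u t) fun s => D.snd.v s * k s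

/-- The right-hand side of the Holmstedt formula. -/
def formula (k : ℝ → ℝ≥0∞) (u : ℝ) : ℝ≥0∞ :=
  D.head k u + D.fst.tail u * D.fst.inner k u + D.ratio u * D.rest k u

theorem ratio_mul {u : ℝ} (hu : 0 < u) :
    D.ratio u * (D.snd.v u * D.snd.tail u) = D.fst.v u * D.fst.tail u := by
  rw [ratio, mul_assoc, ENNReal.inv_mul_cancel (D.snd.regVar_v_mul_tail.ne_zero u hu)
    (D.snd.regVar_v_mul_tail.ne_top u hu), mul_one]

/-- The first two terms are parts of the norm. In the third, `le_total` replaces `k` by `1/(v₀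
tail₀)`; the weight `v₁/(v₀ tail₀)` has index `θ₀ - θ₁ < 0`, so the inner norm is bounded by its
value at `u`, which `ratio` cancels. -/
theorem formula_le_total_fst : ∃ C : ℝ≥0, ∀ k, QuasiConcave k → ∀ u, 0 < u →
    D.formula k u ≤ C * D.fst.total k := by
  obtain ⟨A, hA⟩ := D.fst.le_total
  have hreg := D.snd.regVar_v.mul D.fst.regVar_v_mul_tail.inv
  obtain ⟨C, hC⟩ := hreg.tildeOn_Ioi_le (by linarith [D.lt]) D.snd.F
  refine ⟨1 + 1 + A * C, fun k hk u hu => ?_⟩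
  set Y := D.fst.total k
  have h1 : D.head k u ≤ Y := D.fst.E.tildeOn_le_tilde _ _
  have h2 : D.fst.tail u * D.fst.inner k u ≤ Y := D.fst.tail_mul_inner_le_total k u
  set c : ℝ≥0∞ := A * Y * (C * (D.snd.v u * (D.fst.v u * D.fst.tail u)⁻¹))
  have hin : ∀ t, D.snd.F.tildeOn (Ioo u t) (fun s => D.snd.v s * k s) ≤ c := fun t => by
    refine (D.snd.F.tildeOn_mono Ioo_subset_Ioi_self fun _ _ => le_rfl).trans ?_
    refine (D.snd.F.tildeOn_le_const_mul measurableSet_Ioi (c := A * Y) hreg.aemeasurable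
      fun s hs => ?_).trans (mul_le_mul_right (hC u hu) _)
    calc D.snd.v s * k s ≤ D.snd.v s * (A * Y * (D.fst.v s * D.fst.tail s)⁻¹) := by
          gcongr
          exact hA k hk s (hu.trans hs)
      _ = _ := by ring
  have h3 : D.rest k u ≤ c * D.snd.tail u := by
    refine D.snd.E.tildeOn_le_const_mul measurableSet_Ioi D.snd.regVar_b.aemeasurable
      fun t _ => ?_
    rw [mul_comm c]
    gcongr
    exact hin t
  have h4 : D.ratio u * D.rest k u ≤ A * C * Y := by
    calc D.ratio u * D.rest k u ≤ D.ratio u * (c * D.snd.tail u) := by gcongr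
      _ = A * C * Y * ((D.ratio u * (D.snd.v u * D.snd.tail u)) *
            (D.fst.v u * D.fst.tail u)⁻¹) := by ring
      _ = A * C * Y := by
        rw [D.ratio_mul hu, ENNReal.mul_inv_cancel (D.fst.regVar_v_mul_tail.ne_zero u hu)
          (D.fst.regVar_v_mul_tail.ne_top u hu), mul_one]
  calc D.formula k u ≤ Y + Y + A * C * Y := by
        unfold formula
        gcongr
    _ = _ := by
        push_cast
        ring

/-- Here the third term is part of the norm. After `le_total` the weight `q = v₀/(v₁ tail₁)` has
index `θ₁ - θ₀ > 0`, as has `b₀ q`, so both norms over `(0,u)` reduce to values at `u`, and `tail₀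
q` is `ratio`. -/
theorem formula_le_total_snd : ∃ C : ℝ≥0, ∀ k, QuasiConcave k → ∀ u, 0 < u →
    D.formula k u ≤ C * (D.ratio u * D.snd.total k) := by
  obtain ⟨A, hA⟩ := D.snd.le_total
  have hreg := D.fst.regVar_v.mul D.snd.regVar_v_mul_tail.inv
  obtain ⟨C, hC⟩ := hreg.tildeOn_Ioo_le (by linarith [D.lt]) D.fst.F
  have hreg' := D.fst.regVar_b.mul hreg
  obtain ⟨C', hC'⟩ := hreg'.tildeOn_Ioo_le (by linarith [D.lt]) D.fst.E
  obtain ⟨M, hM⟩ := D.fst.b_le_tail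
  refine ⟨A * C * C' * M + A * C + 1, fun k hk u hu => ?_⟩
  set Y := D.snd.total k
  set q : ℝ → ℝ≥0∞ := fun t => D.fst.v t * (D.snd.v t * D.snd.tail t)⁻¹
  have hq : D.fst.tail u * q u = D.ratio u := by
    simp only [q, ratio]
    ring
  have hin : ∀ t, 0 < t → D.fst.inner k t ≤ A * Y * (C * q t) := fun t ht => by
    refine (D.fst.F.tildeOn_le_const_mul measurableSet_Ioo (c := A * Y) hreg.aemeasurable
      fun s hs => ?_).trans (mul_le_mul_right (hC t ht) _)
    calc D.fst.v s * k s ≤ D.fst.v s * (A * Y * (D.snd.v s * D.snd.tail s)⁻¹) := by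
          gcongr
          exact hA k hk s hs.1
      _ = _ := by ring
  have h1 : D.head k u ≤ A * C * C' * M * (D.ratio u * Y) := by
    calc D.head k u ≤ A * C * Y * D.fst.E.tildeOn (Ioo 0 u) fun t => D.fst.b t * q t := by
          refine D.fst.E.tildeOn_le_const_mul measurableSet_Ioo hreg'.aemeasurable fun t ht => ?_
          calc D.fst.b t * D.fst.inner k t ≤ D.fst.b t * (A * Y * (C * q t)) := by
                gcongr
                exact hin t ht.1
            _ = _ := by ring
      _ ≤ A * C * Y * (C' * (D.fst.b u * q u)) := by gcongr; exact hC' u hu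
      _ ≤ A * C * Y * (C' * (M * D.fst.tail u * q u)) := by gcongr; exact hM u hu
      _ = A * C * C' * M * ((D.fst.tail u * q u) * Y) := by ring
      _ = _ := by rw [hq]
  have h2 : D.fst.tail u * D.fst.inner k u ≤ A * C * (D.ratio u * Y) := by
    calc D.fst.tail u * D.fst.inner k u ≤ D.fst.tail u * (A * Y * (C * q u)) := by
          gcongr
          exact hin u hu
      _ = A * C * ((D.fst.tail u * q u) * Y) := by ring
      _ = _ := by rw [hq]
  have h3 : D.rest k u ≤ Y := by
    refine le_trans (D.snd.E.tildeOn_mono subset_rfl fun t _ => ?_)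
      (D.snd.E.tildeOn_le_tilde (Ioi u) _)
    gcongr
    exact D.snd.F.tildeOn_mono (Ioo_subset_Ioo_left hu.le) fun _ _ => le_rfl
  calc D.formula k u ≤ A * C * C' * M * (D.ratio u * Y) + A * C * (D.ratio u * Y)
        + D.ratio u * Y := by
        unfold formula
        gcongr
    _ = _ := by
        push_cast
        ring

theorem inner_le_add (S : LSpace) {c : ℝ≥0∞} {k k₀ k₁ : ℝ → ℝ≥0∞} (hk₀ : QuasiConcave k₀)
    (hk₁ : QuasiConcave k₁) (h : ∀ t, k t ≤ c * (k₀ t + k₁ t)) {I : Set ℝ}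
    (hI : MeasurableSet I) :
    S.F.tildeOn I (fun s => S.v s * k s)
      ≤ c * (S.F.tildeOn I (fun s => S.v s * k₀ s) + S.F.tildeOn I (fun s => S.v s * k₁ s)) := by
  have m₀ := S.aemeasurable_v_mul hk₀
  have m₁ := S.aemeasurable_v_mul hk₁
  refine (S.F.tildeOn_le_const_mul hI (c := c) (m₀.add m₁) fun s _ => ?_).trans
    (mul_le_mul_right (S.F.tildeOn_add_le hI m₀ m₁) c)
  calc S.v s * k s ≤ S.v s * (c * (k₀ s + k₁ s)) := by gcongr; exact h s
    _ = c * (S.v s * k₀ s + S.v s * k₁ s) := by ring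

theorem outer_le_add (S : LSpace) {c : ℝ≥0∞} {g g₀ g₁ : ℝ → ℝ≥0∞} (hg₀ : Monotone g₀)
    (hg₁ : Monotone g₁) (h : ∀ t, g t ≤ c * (g₀ t + g₁ t)) {I : Set ℝ} (hI : MeasurableSet I) :
    S.E.tildeOn I (fun s => S.b s * g s)
      ≤ c * (S.E.tildeOn I (fun s => S.b s * g₀ s) + S.E.tildeOn I (fun s => S.b s * g₁ s)) := by
  have m₀ := S.aemeasurable_b_mul hg₀
  have m₁ := S.aemeasurable_b_mul hg₁
  refine (S.E.tildeOn_le_const_mul hI (c := c) (m₀.add m₁) fun s _ => ?_).trans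
    (mul_le_mul_right (S.E.tildeOn_add_le hI m₀ m₁) c)
  calc S.b s * g s ≤ S.b s * (c * (g₀ s + g₁ s)) := by gcongr; exact h s
    _ = c * (S.b s * g₀ s + S.b s * g₁ s) := by ring

theorem formula_le_add {c : ℝ≥0∞} {k k₀ k₁ : ℝ → ℝ≥0∞} (hk₀ : QuasiConcave k₀)
    (hk₁ : QuasiConcave k₁) (h : ∀ t, k t ≤ c * (k₀ t + k₁ t)) (u : ℝ) :
    D.formula k u ≤ c * (D.formula k₀ u + D.formula k₁ u) := by
  have hin : ∀ t, D.fst.inner k t ≤ c * (D.fst.inner k₀ t + D.fst.inner k₁ t) := fun t =>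
    inner_le_add D.fst hk₀ hk₁ h measurableSet_Ioo
  have h1 : D.head k u ≤ c * (D.head k₀ u + D.head k₁ u) :=
    outer_le_add D.fst (D.fst.inner_mono _) (D.fst.inner_mono _) hin measurableSet_Ioo
  have h3 : D.rest k u ≤ c * (D.rest k₀ u + D.rest k₁ u) :=
    outer_le_add D.snd (D.snd.F.monotone_tildeOn_Ioo u _) (D.snd.F.monotone_tildeOn_Ioo u _)
      (fun t => inner_le_add D.snd hk₀ hk₁ h measurableSet_Ioo) measurableSet_Ioi
  calc D.formula k u ≤ c * (D.head k₀ u + D.head k₁ u)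
        + D.fst.tail u * (c * (D.fst.inner k₀ u + D.fst.inner k₁ u))
        + D.ratio u * (c * (D.rest k₀ u + D.rest k₁ u)) := by
        unfold formula
        gcongr
        exact hin u
    _ = _ := by
        unfold formula
        ring

/-- The hypotheses on `k₀` are those met by the first part of a near-optimal decomposition. Beyond
`u` the inner norm grows by at most a constant times `v₀(u) k(u)`, because `v₀` has negative index.
-/
theorem total_fst_le : ∃ C : ℝ≥0, ∀ (c : ℝ≥0∞) (k k₀ : ℝ → ℝ≥0∞) (u : ℝ), 0 < u →
    QuasiConcave k → QuasiConcave k₀ → (∀ s, 0 < s → s ≤ u → k₀ s ≤ c * k s) →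
    (∀ s, 0 < s → k₀ s ≤ c * k u) → D.fst.total k₀ ≤ C * (c * D.formula k u) := by
  obtain ⟨A, hA⟩ := D.fst.v_mul_le_inner
  obtain ⟨C, hC⟩ := D.fst.regVar_v.tildeOn_Ioi_le (by linarith [D.fst.pos]) D.fst.F
  refine ⟨1 + C * A, fun c k k₀ u hu hk hk₀ hle hge => ?_⟩
  set S := D.fst
  have hmono : ∀ t, t ≤ u → S.inner k₀ t ≤ c * S.inner k t := fun t htu =>
    S.F.tildeOn_le_const_mul measurableSet_Ioo (S.aemeasurable_v_mul hk) fun s hs => by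
      calc S.v s * k₀ s ≤ S.v s * (c * k s) := by gcongr; exact hle s hs.1 (hs.2.le.trans htu)
        _ = _ := by ring
  have h1 : S.E.tildeOn (Ioo 0 u) (fun t => S.b t * S.inner k₀ t) ≤ c * D.head k u :=
    S.E.tildeOn_le_const_mul measurableSet_Ioo (S.aemeasurable_b_mul (S.inner_mono k))
      fun t ht => by
        calc S.b t * S.inner k₀ t ≤ S.b t * (c * S.inner k t) := by gcongr; exact hmono t ht.2.le
          _ = _ := by ring
  have hfar : ∀ t, S.inner k₀ t ≤ (1 + C * A) * (c * S.inner k u) := fun t => by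
    have hfar' : S.F.tildeOn (Ioo u t) (fun s => S.v s * k₀ s) ≤ c * k u * (C * S.v u) := by
      refine (S.F.tildeOn_mono Ioo_subset_Ioi_self fun _ _ => le_rfl).trans ?_
      refine (S.F.tildeOn_le_const_mul measurableSet_Ioi (c := c * k u) S.regVar_v.aemeasurable
        fun s hs => ?_).trans (mul_le_mul_right (hC u hu) _)
      rw [mul_comm]
      gcongr
      exact hge s (hu.trans hs)
    calc S.inner k₀ t ≤ S.inner k₀ u + S.F.tildeOn (Ioo u t) (fun s => S.v s * k₀ s) :=
          S.F.tildeOn_Ioo_le_add u t (S.aemeasurable_v_mul hk₀)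
      _ ≤ c * S.inner k u + c * k u * (C * S.v u) := by
          gcongr
          exact hmono u le_rfl
      _ = c * S.inner k u + c * C * (S.v u * k u) := by ring
      _ ≤ c * S.inner k u + c * C * (A * S.inner k u) :=
          add_le_add_right (mul_le_mul_right (hA k hk u hu) _) _
      _ = _ := by ring
  have h2 : S.E.tildeOn (Ioi u) (fun t => S.b t * S.inner k₀ t)
      ≤ (1 + C * A) * (c * S.inner k u) * S.tail u :=
    S.E.tildeOn_le_const_mul measurableSet_Ioi S.regVar_b.aemeasurable fun t _ => by
      rw [mul_comm]
      gcongr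
      exact hfar t
  calc S.total k₀ ≤ c * D.head k u + (1 + C * A) * (c * S.inner k u) * S.tail u :=
        (S.E.tilde_le_add u (S.aemeasurable_b_mul (S.inner_mono k₀))).trans (add_le_add h1 h2)
    _ ≤ (1 + C * A) * (c * D.head k u) + (1 + C * A) * (c * S.inner k u) * S.tail u := by
        refine add_le_add_left ?_ _
        exact le_mul_of_one_le_left' le_self_add
    _ = (1 + C * A) * (c * (D.head k u + S.tail u * S.inner k u)) := by ring
    _ ≤ (1 + C * A) * (c * D.formula k u) := by
        gcongr
        exact le_self_add
    _ = _ := by push_cast; rfl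

/-- Counterpart for the second part. Below `u`, `k₁` is essentially linear and `s v₁(s)` has index
`1 - θ₁ > 0`, so only a boundary term at `u` remains; beyond `u` there is in addition `rest`. -/
theorem total_snd_le : ∃ C : ℝ≥0, ∀ (c : ℝ≥0∞) (k k₁ : ℝ → ℝ≥0∞) (u : ℝ), 0 < u →
    QuasiConcave k → QuasiConcave k₁ →
    (∀ s, 0 < s → s ≤ u → k₁ s ≤ c * (pw 1 s * (pw (-1) u * k u))) →
    (∀ s, u ≤ s → k₁ s ≤ c * k s) → D.ratio u * D.snd.total k₁ ≤ C * (c * D.formula k u) := by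
  obtain ⟨A, hA⟩ := D.fst.v_mul_le_inner
  have hreg := D.snd.regVar_v.mul (RegVar.pw 1)
  have hpos : 0 < -D.snd.θ + 1 := by linarith [D.snd.lt_one]
  obtain ⟨C, hC⟩ := hreg.tildeOn_Ioo_le hpos D.snd.F
  have hreg' := D.snd.regVar_b.mul hreg
  obtain ⟨C', hC'⟩ := hreg'.tildeOn_Ioo_le (by linarith) D.snd.E
  obtain ⟨M, hM⟩ := D.snd.b_le_tail
  refine ⟨C * C' * M * A + C * A + 1, fun c k k₁ u hu hk hk₁ hle hge => ?_⟩
  set S := D.snd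
  set p : ℝ≥0∞ := pw (-1) u * k u
  have hp : S.v u * pw 1 u * p = S.v u * k u := by
    calc S.v u * pw 1 u * p = pw 1 u * pw (-1) u * (S.v u * k u) := by simp only [p]; ring
      _ = _ := by rw [pw_one_mul_neg_one hu, one_mul]
  have hnear : ∀ t, 0 < t → t ≤ u → S.inner k₁ t ≤ c * p * (C * (S.v t * pw 1 t)) :=
    fun t ht htu => by
      refine (S.F.tildeOn_le_const_mul measurableSet_Ioo (c := c * p) hreg.aemeasurable
        fun s hs => ?_).trans (mul_le_mul_right (hC t ht) _)
      calc S.v s * k₁ s ≤ S.v s * (c * (pw 1 s * p)) := by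
            gcongr
            exact hle s hs.1 (hs.2.le.trans htu)
        _ = _ := by ring
  have h1 : S.E.tildeOn (Ioo 0 u) (fun t => S.b t * S.inner k₁ t)
      ≤ c * C * C' * M * (S.v u * S.tail u * k u) := by
    calc _ ≤ c * p * C * S.E.tildeOn (Ioo 0 u) fun t => S.b t * (S.v t * pw 1 t) := by
          refine S.E.tildeOn_le_const_mul measurableSet_Ioo hreg'.aemeasurable fun t ht => ?_
          calc S.b t * S.inner k₁ t ≤ S.b t * (c * p * (C * (S.v t * pw 1 t))) := by
                gcongr
                exact hnear t ht.1 ht.2.le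
            _ = _ := by ring
      _ ≤ c * p * C * (C' * (S.b u * (S.v u * pw 1 u))) := by gcongr; exact hC' u hu
      _ ≤ c * p * C * (C' * (M * S.tail u * (S.v u * pw 1 u))) := by gcongr; exact hM u hu
      _ = c * C * C' * M * S.tail u * (S.v u * pw 1 u * p) := by ring
      _ = _ := by rw [hp]; ring
  have hnear_u : S.inner k₁ u ≤ c * C * (S.v u * k u) := by
    refine (hnear u hu le_rfl).trans_eq ?_
    rw [← hp]
    ring
  have hfar : ∀ t, S.inner k₁ t
      ≤ 1 * (c * C * (S.v u * k u) + c * S.F.tildeOn (Ioo u t) fun s => S.v s * k s) := fun t => by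
    rw [one_mul]
    refine (S.F.tildeOn_Ioo_le_add u t (S.aemeasurable_v_mul hk₁)).trans
      (add_le_add hnear_u ?_)
    refine S.F.tildeOn_le_const_mul measurableSet_Ioo (S.aemeasurable_v_mul hk) fun s hs => ?_
    calc S.v s * k₁ s ≤ S.v s * (c * k s) := by gcongr; exact hge s hs.1.le
      _ = _ := by ring
  have h2 : S.E.tildeOn (Ioi u) (fun t => S.b t * S.inner k₁ t)
      ≤ c * C * (S.v u * S.tail u * k u) + c * D.rest k u := by
    have hmono := S.F.monotone_tildeOn_Ioo u fun s => S.v s * k s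
    refine (outer_le_add S (g₀ := fun _ => c * C * (S.v u * k u)) monotone_const
      (hmono.const_mul' c) hfar measurableSet_Ioi).trans ?_
    rw [one_mul]
    refine add_le_add ?_ ?_
    · refine (S.E.tildeOn_le_const_mul (c := c * C * (S.v u * k u)) measurableSet_Ioi
        S.regVar_b.aemeasurable fun t _ => (mul_comm _ _).le).trans_eq ?_
      change _ * S.tail u = _
      ring
    · refine S.E.tildeOn_le_const_mul measurableSet_Ioi (S.aemeasurable_b_mul hmono)
        fun t _ => le_of_eq ?_
      ring
  -- Multiplication by `ratio` turns the boundary term of the second space into that of the first,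
  -- which the middle term absorbs.
  have h3 : D.ratio u * (S.v u * S.tail u * k u) ≤ A * (D.fst.tail u * D.fst.inner k u) := by
    calc D.ratio u * (S.v u * S.tail u * k u) = D.ratio u * (S.v u * S.tail u) * k u := by ring
      _ = D.fst.tail u * (D.fst.v u * k u) := by rw [D.ratio_mul hu]; ring
      _ ≤ D.fst.tail u * (A * D.fst.inner k u) := mul_le_mul_right (hA k hk u hu) _
      _ = _ := by ring
  have hform : D.fst.tail u * D.fst.inner k u ≤ D.formula k u :=
    le_trans le_add_self le_self_add
  have hrest : D.ratio u * D.rest k u ≤ D.formula k u := le_add_self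
  calc D.ratio u * S.total k₁
      ≤ D.ratio u * (c * C * C' * M * (S.v u * S.tail u * k u)
        + (c * C * (S.v u * S.tail u * k u) + c * D.rest k u)) := by
        gcongr
        exact (S.E.tilde_le_add u (S.aemeasurable_b_mul (S.inner_mono k₁))).trans
          (add_le_add h1 h2)
    _ = (c * C * C' * M + c * C) * (D.ratio u * (S.v u * S.tail u * k u))
        + c * (D.ratio u * D.rest k u) := by ring
    _ ≤ (c * C * C' * M + c * C) * (A * D.formula k u) + c * D.formula k u :=
        add_le_add (mul_le_mul_right (h3.trans (mul_le_mul_right hform _)) _)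
          (mul_le_mul_right hrest _)
    _ = _ := by
        push_cast
        ring

end LCouple

/-! ### The K-functional -/

section Peetre

variable {V : Type*} [AddCommGroup V] {N₀ N₁ : V → ℝ≥0∞}

theorem K_add_le_of_eq {t : ℝ≥0∞} {f f₀ f₁ : V} (h : f = f₀ + f₁) :
    K N₀ N₁ t f ≤ N₀ f₀ + t * N₁ f₁ :=
  iInf₂_le_of_le f₀ f₁ (iInf_le _ h)

theorem exists_lt_of_K_lt {t r : ℝ≥0∞} {f : V} (h : K N₀ N₁ t f < r) :
    ∃ f₀ f₁, f = f₀ + f₁ ∧ N₀ f₀ + t * N₁ f₁ < r := by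
  simp only [K, iInf_lt_iff] at h
  obtain ⟨f₀, f₁, hf, hlt⟩ := h
  exact ⟨f₀, f₁, hf, hlt⟩

theorem le_mul_K {t c x : ℝ≥0∞} {f : V} (hc : c ≠ ∞)
    (h : ∀ f₀ f₁, f = f₀ + f₁ → x ≤ c * (N₀ f₀ + t * N₁ f₁)) : x ≤ c * K N₀ N₁ t f := by
  by_contra! hlt
  rcases eq_or_ne c 0 with rfl | hc0
  · simpa using hlt.trans_le (h f 0 (add_zero f).symm)
  rw [mul_comm, ← ENNReal.lt_div_iff_mul_lt (.inl hc0) (.inl hc)] at hlt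
  obtain ⟨f₀, f₁, hf, hlt⟩ := exists_lt_of_K_lt hlt
  rw [ENNReal.lt_div_iff_mul_lt (.inl hc0) (.inl hc), mul_comm] at hlt
  exact absurd (h f₀ f₁ hf) (not_le.2 hlt)

theorem MemSum.K_lt_top {f : V} (h : MemSum N₀ N₁ f) {t : ℝ≥0∞} (ht : t ≠ ∞) :
    K N₀ N₁ t f < ∞ := by
  obtain ⟨f₀, f₁, hf, hlt₀, hlt₁⟩ := h
  exact (K_add_le_of_eq hf).trans_lt
    (ENNReal.add_lt_top.2 ⟨hlt₀, ENNReal.mul_lt_top ht.lt_top hlt₁⟩)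

theorem quasiConcave_K (N₀ N₁ : V → ℝ≥0∞) (f : V) :
    QuasiConcave fun s => K N₀ N₁ (ENNReal.ofReal s) f where
  mono s t hst := by
    refine le_iInf fun f₀ => le_iInf fun f₁ => le_iInf fun h => ?_
    refine (K_add_le_of_eq h).trans ?_
    gcongr
  mul_le s t hs hst := by
    refine le_mul_K (pw_ne_top _ _) fun f₀ f₁ h => ?_
    calc pw 1 s * K N₀ N₁ (ENNReal.ofReal t) f
        ≤ pw 1 s * (N₀ f₀ + ENNReal.ofReal t * N₁ f₁) := mul_le_mul_right (K_add_le_of_eq h) _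
      _ = pw 1 s * N₀ f₀ + pw 1 t * (ENNReal.ofReal s * N₁ f₁) := by
          rw [pw_one, pw_one]; ring
      _ ≤ pw 1 t * N₀ f₀ + pw 1 t * (ENNReal.ofReal s * N₁ f₁) := by
          gcongr
          exact pw_mono hs.le hst zero_le_one
      _ = _ := by ring

open Classical in
/-- The extended quasi-norm of the space with parameters `S`. -/
def LSpace.extNorm (N₀ N₁ : V → ℝ≥0∞) (S : LSpace) (f : V) : ℝ≥0∞ :=
  if MemSum N₀ N₁ f then S.total fun s => K N₀ N₁ (ENNReal.ofReal s) f else ∞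

theorem LSpace.total_le_extNorm (N₀ N₁ : V → ℝ≥0∞) (S : LSpace) (f : V) :
    (S.total fun s => K N₀ N₁ (ENNReal.ofReal s) f) ≤ S.extNorm N₀ N₁ f := by
  unfold extNorm
  split_ifs
  · exact le_rfl
  · exact le_top

theorem LSpace.memSum_of_extNorm_lt_top {S : LSpace} {f : V} (h : S.extNorm N₀ N₁ f < ∞) :
    MemSum N₀ N₁ f := by
  by_contra hf
  simp [extNorm, hf] at h

variable {𝕜 : Type*} [RCLike 𝕜] [Module 𝕜 V] [TopologicalSpace V]

namespace IsQuasiBanach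

variable {N : V → ℝ≥0∞}

theorem map_zero (h : IsQuasiBanach 𝕜 N) : N 0 = 0 := by
  simpa using h.smul 0 0

theorem map_neg (h : IsQuasiBanach 𝕜 N) (f : V) : N (-f) = N f := by
  simpa using h.smul (-1) f

end IsQuasiBanach

theorem K_le_left (h₁ : IsQuasiBanach 𝕜 N₁) (t : ℝ≥0∞) (f : V) : K N₀ N₁ t f ≤ N₀ f := by
  simpa [h₁.map_zero] using K_add_le_of_eq (N₀ := N₀) (N₁ := N₁) (t := t) (add_zero f).symm

theorem K_le_right (h₀ : IsQuasiBanach 𝕜 N₀) (t : ℝ≥0∞) (f : V) :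
    K N₀ N₁ t f ≤ t * N₁ f := by
  simpa [h₀.map_zero] using K_add_le_of_eq (N₀ := N₀) (N₁ := N₁) (t := t) (zero_add f).symm

theorem K_neg_le (h₀ : IsQuasiBanach 𝕜 N₀) (h₁ : IsQuasiBanach 𝕜 N₁) (t : ℝ≥0∞) (f : V) :
    K N₀ N₁ t (-f) ≤ K N₀ N₁ t f := by
  refine le_iInf fun f₀ => le_iInf fun f₁ => le_iInf fun h => ?_
  have hf : -f = -f₀ + -f₁ := by rw [h]; abel
  simpa [h₀.map_neg, h₁.map_neg] using K_add_le_of_eq (N₀ := N₀) (N₁ := N₁) (t := t) hf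

theorem exists_K_add_le (h₀ : IsQuasiBanach 𝕜 N₀) (h₁ : IsQuasiBanach 𝕜 N₁) :
    ∃ κ : ℝ≥0, ∀ (t : ℝ≥0∞) (f g : V),
      K N₀ N₁ t (f + g) ≤ κ * (K N₀ N₁ t f + K N₀ N₁ t g) := by
  obtain ⟨κ₀, hκ₀⟩ := h₀.add_le
  obtain ⟨κ₁, hκ₁⟩ := h₁.add_le
  set κ := max κ₀ κ₁
  refine ⟨κ, fun t f g => ?_⟩
  refine ENNReal.le_of_forall_pos_le_add fun ε hε hfin => ?_
  -- The definition allows `κ = 0`, which must be excluded before dividing by it.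
  rcases eq_or_ne κ 0 with h0 | h0
  · have : K N₀ N₁ t (f + g) ≤ 0 := by
      refine (K_le_left h₁ t _).trans ((hκ₀ f g).trans ?_)
      have : κ₀ = 0 := le_antisymm ((le_max_left _ _).trans_eq h0) zero_le
      simp [this]
    exact this.trans zero_le
  have hκ : (κ : ℝ≥0∞) ≠ 0 := by exact_mod_cast h0
  have hsum : K N₀ N₁ t f + K N₀ N₁ t g ≠ ∞ := fun h => by
    rw [h, ENNReal.mul_top hκ] at hfin
    exact hfin.ne rfl
  obtain ⟨hf, hg⟩ := ENNReal.add_ne_top.1 hsum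
  set δ : ℝ≥0∞ := ε / κ / 2
  have hδ : δ ≠ 0 := by simp [δ, hε.ne']
  obtain ⟨f₀, f₁, hf', hlf⟩ := exists_lt_of_K_lt (ENNReal.lt_add_right hf hδ)
  obtain ⟨g₀, g₁, hg', hlg⟩ := exists_lt_of_K_lt (ENNReal.lt_add_right hg hδ)
  have hfg : f + g = (f₀ + g₀) + (f₁ + g₁) := by rw [hf', hg']; abel
  calc K N₀ N₁ t (f + g) ≤ N₀ (f₀ + g₀) + t * N₁ (f₁ + g₁) := K_add_le_of_eq hfg
    _ ≤ κ * (N₀ f₀ + N₀ g₀) + t * (κ * (N₁ f₁ + N₁ g₁)) := by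
        refine add_le_add ((hκ₀ _ _).trans ?_) (mul_le_mul_right ((hκ₁ _ _).trans ?_) _)
        · gcongr
          exact le_max_left _ _
        · gcongr
          exact le_max_right _ _
    _ = κ * ((N₀ f₀ + t * N₁ f₁) + (N₀ g₀ + t * N₁ g₁)) := by ring
    _ ≤ κ * ((K N₀ N₁ t f + δ) + (K N₀ N₁ t g + δ)) := by gcongr
    _ = κ * (K N₀ N₁ t f + K N₀ N₁ t g) + κ * (δ + δ) := by ring
    _ = _ := by rw [ENNReal.add_halves, ENNReal.mul_div_cancel hκ ENNReal.coe_ne_top]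

/-- Decompositions of arbitrarily small cost have both parts near `0`, which the Hausdorff property
forbids for `f ≠ 0`. -/
theorem eq_zero_of_K_eq_zero [IsTopologicalAddGroup V] [T2Space V] (h₀ : IsQuasiBanach 𝕜 N₀)
    (h₁ : IsQuasiBanach 𝕜 N₁) {t : ℝ≥0∞} (ht : t ≠ 0) (ht' : t ≠ ∞) {f : V}
    (h : K N₀ N₁ t f = 0) : f = 0 := by
  by_contra hf
  have hU : {f}ᶜ ∈ 𝓝 (0 : V) := isOpen_compl_singleton.mem_nhds (Ne.symm hf)
  obtain ⟨W, hW, hWU⟩ := exists_nhds_zero_half hU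
  obtain ⟨ε₀, hε₀, hW₀⟩ := h₀.continuous_embedding W hW
  obtain ⟨ε₁, hε₁, hW₁⟩ := h₁.continuous_embedding W hW
  have hpos : K N₀ N₁ t f < min ε₀ (t * ε₁) := by
    rw [h]
    exact lt_min hε₀ (ENNReal.mul_pos ht hε₁.ne')
  obtain ⟨f₀, f₁, hf', hlt⟩ := exists_lt_of_K_lt hpos
  have hf₀ : N₀ f₀ < ε₀ := le_self_add.trans_lt (hlt.trans_le (min_le_left _ _))
  have hf₁ : N₁ f₁ < ε₁ :=
    (ENNReal.mul_lt_mul_iff_right ht ht').1 (le_add_self.trans_lt (hlt.trans_le (min_le_right _ _)))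
  exact hWU f₀ (hW₀ f₀ hf₀) f₁ (hW₁ f₁ hf₁) hf'.symm

theorem MemSum.add (h₀ : IsQuasiBanach 𝕜 N₀) (h₁ : IsQuasiBanach 𝕜 N₁) {f g : V}
    (hf : MemSum N₀ N₁ f) (hg : MemSum N₀ N₁ g) : MemSum N₀ N₁ (f + g) := by
  obtain ⟨f₀, f₁, rfl, hf₀, hf₁⟩ := hf
  obtain ⟨g₀, g₁, rfl, hg₀, hg₁⟩ := hg
  obtain ⟨κ₀, hκ₀⟩ := h₀.add_le
  obtain ⟨κ₁, hκ₁⟩ := h₁.add_le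
  refine ⟨f₀ + g₀, f₁ + g₁, by abel, (hκ₀ _ _).trans_lt ?_, (hκ₁ _ _).trans_lt ?_⟩
  · exact ENNReal.mul_lt_top ENNReal.coe_lt_top (ENNReal.add_lt_top.2 ⟨hf₀, hg₀⟩)
  · exact ENNReal.mul_lt_top ENNReal.coe_lt_top (ENNReal.add_lt_top.2 ⟨hf₁, hg₁⟩)

/-- A decomposition that is optimal up to the factor `2` at `u`, and the K-functionals of its
parts. -/
theorem exists_near_optimal [IsTopologicalAddGroup V] [T2Space V] (h₀ : IsQuasiBanach 𝕜 N₀)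
    (h₁ : IsQuasiBanach 𝕜 N₁) : ∃ c : ℝ≥0, ∀ f : V, MemSum N₀ N₁ f → ∀ u : ℝ, 0 < u →
    ∃ f₀ f₁ : V, f = f₀ + f₁ ∧ MemSum N₀ N₁ f₀ ∧ MemSum N₀ N₁ f₁ ∧
      (∀ s, 0 < s → s ≤ u →
        K N₀ N₁ (ENNReal.ofReal s) f₀ ≤ c * K N₀ N₁ (ENNReal.ofReal s) f) ∧
      (∀ s, 0 < s → K N₀ N₁ (ENNReal.ofReal s) f₀ ≤ c * K N₀ N₁ (ENNReal.ofReal u) f) ∧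
      (∀ s, 0 < s → s ≤ u → K N₀ N₁ (ENNReal.ofReal s) f₁
        ≤ c * (pw 1 s * (pw (-1) u * K N₀ N₁ (ENNReal.ofReal u) f))) ∧
      (∀ s, u ≤ s → K N₀ N₁ (ENNReal.ofReal s) f₁ ≤ c * K N₀ N₁ (ENNReal.ofReal s) f) := by
  obtain ⟨κ, hκ⟩ := exists_K_add_le h₀ h₁
  -- The `2` is the loss of near-optimality; `3κ = κ(1 + 2)` arises from writing one part as `f`
  -- minus the other.
  refine ⟨2 + κ * 3, fun f hf u hu => ?_⟩
  have hu0 : ENNReal.ofReal u ≠ 0 := (ENNReal.ofReal_pos.2 hu).ne'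
  have hq := quasiConcave_K N₀ N₁ f
  have hfin := hf.K_lt_top (t := ENNReal.ofReal u) ENNReal.ofReal_ne_top
  set k : ℝ → ℝ≥0∞ := fun s => K N₀ N₁ (ENNReal.ofReal s) f
  obtain ⟨f₀, f₁, hff, hlt₀, hlt₁, hle⟩ : ∃ f₀ f₁ : V, f = f₀ + f₁ ∧ N₀ f₀ < ∞ ∧ N₁ f₁ < ∞ ∧
      N₀ f₀ + ENNReal.ofReal u * N₁ f₁ ≤ 2 * k u := by
    -- The factor `2` gives strict room only when `k u ≠ 0`; otherwise `f = 0`.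
    rcases eq_or_ne (k u) 0 with h0 | h0
    · have : f = 0 := eq_zero_of_K_eq_zero h₀ h₁ hu0 ENNReal.ofReal_ne_top h0
      exact ⟨0, 0, by rw [this, add_zero], by simp [h₀.map_zero], by simp [h₁.map_zero],
        by simp [h₀.map_zero, h₁.map_zero]⟩
    · have : k u < 2 * k u := by
        rw [two_mul]
        exact ENNReal.lt_add_right hfin.ne h0
      obtain ⟨f₀, f₁, hff, hlt⟩ := exists_lt_of_K_lt this
      have h2 : 2 * k u < ∞ := ENNReal.mul_lt_top ENNReal.ofNat_lt_top hfin
      obtain ⟨h3, h4⟩ := ENNReal.add_lt_top.1 (hlt.trans h2)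
      exact ⟨f₀, f₁, hff, h3, ENNReal.lt_top_of_mul_ne_top_right h4.ne hu0, hlt.le⟩
  have hK₀ : ∀ s : ℝ, K N₀ N₁ (ENNReal.ofReal s) f₀ ≤ 2 * k u := fun s =>
    (K_le_left h₁ _ _).trans (le_self_add.trans hle)
  have hK₁ : ∀ s : ℝ, K N₀ N₁ (ENNReal.ofReal s) f₁ ≤ 2 * (pw 1 s * (pw (-1) u * k u)) := by
    intro s
    calc K N₀ N₁ (ENNReal.ofReal s) f₁ ≤ pw 1 s * N₁ f₁ := by
          rw [pw_one]
          exact K_le_right h₀ _ _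
      _ = pw 1 s * (pw (-1) u * (pw 1 u * N₁ f₁)) := by
          rw [← mul_assoc (pw (-1) u), mul_comm (pw (-1) u), pw_one_mul_neg_one hu, one_mul]
      _ ≤ pw 1 s * (pw (-1) u * (2 * k u)) := by
          rw [pw_one u]
          exact mul_le_mul_right (mul_le_mul_right (le_add_self.trans hle) _) _
      _ = _ := by ring
  have hcast : ((2 + κ * 3 : ℝ≥0) : ℝ≥0∞) = 2 + κ * 3 := by push_cast; rfl
  have h2c : (2 : ℝ≥0∞) ≤ (2 + κ * 3 : ℝ≥0) := by rw [hcast]; exact le_self_add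
  have h3c : κ * 3 ≤ ((2 + κ * 3 : ℝ≥0) : ℝ≥0∞) := by rw [hcast]; exact le_add_self
  have hsub : ∀ {g h : V} (t : ℝ≥0∞), f = g + h →
      K N₀ N₁ t g ≤ κ * (K N₀ N₁ t f + K N₀ N₁ t h) := fun {g h} t hgh => by
    have : g = f + -h := by rw [hgh]; abel
    calc K N₀ N₁ t g = K N₀ N₁ t (f + -h) := by rw [← this]
      _ ≤ κ * (K N₀ N₁ t f + K N₀ N₁ t (-h)) := hκ _ _ _
      _ ≤ _ := by
        gcongr
        exact K_neg_le h₀ h₁ t h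
  refine ⟨f₀, f₁, hff, ⟨f₀, 0, (add_zero _).symm, hlt₀, by simp [h₁.map_zero]⟩,
    ⟨0, f₁, (zero_add _).symm, by simp [h₀.map_zero], hlt₁⟩, fun s hs hsu => ?_, fun s _ => ?_,
    fun s _ _ => ?_, fun s hus => ?_⟩
  · calc K N₀ N₁ (ENNReal.ofReal s) f₀ ≤ κ * (k s + K N₀ N₁ (ENNReal.ofReal s) f₁) :=
          hsub _ hff
      _ ≤ κ * (k s + 2 * k s) := by
          gcongr
          refine (hK₁ s).trans (mul_le_mul_right ?_ _)
          rw [← mul_assoc]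
          exact hq.mul_pw_le hs hsu
      _ = κ * 3 * k s := by ring
      _ ≤ _ := mul_le_mul_left h3c _
  · exact (hK₀ s).trans (mul_le_mul_left h2c _)
  · exact (hK₁ s).trans (mul_le_mul_left h2c _)
  · calc K N₀ N₁ (ENNReal.ofReal s) f₁ ≤ κ * (k s + K N₀ N₁ (ENNReal.ofReal s) f₀) :=
          hsub _ (hff.trans (add_comm _ _))
      _ ≤ κ * (k s + 2 * k s) := by
          gcongr
          exact (hK₀ s).trans (mul_le_mul_right (hq.mono hus) _)
      _ = κ * 3 * k s := by ring
      _ ≤ _ := mul_le_mul_left h3c _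

/-! ### The Holmstedt formula -/

theorem LCouple.exists_formula_le_K (D : LCouple) (h₀ : IsQuasiBanach 𝕜 N₀)
    (h₁ : IsQuasiBanach 𝕜 N₁) : ∃ C : ℝ≥0, ∀ (f : V) (u : ℝ), 0 < u →
    D.formula (fun s => K N₀ N₁ (ENNReal.ofReal s) f) u
      ≤ C * K (D.fst.extNorm N₀ N₁) (D.snd.extNorm N₀ N₁) (D.ratio u) f := by
  obtain ⟨κ, hκ⟩ := exists_K_add_le h₀ h₁
  obtain ⟨A, hA⟩ := D.formula_le_total_fst
  obtain ⟨B, hB⟩ := D.formula_le_total_snd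
  refine ⟨κ * (A + B), fun f u hu => le_mul_K ENNReal.coe_ne_top fun f₀ f₁ hf => ?_⟩
  have q₀ := quasiConcave_K N₀ N₁ f₀
  have q₁ := quasiConcave_K N₀ N₁ f₁
  refine (D.formula_le_add q₀ q₁ (fun t => hf ▸ hκ _ _ _) u).trans ?_
  have e₀ := (hA _ q₀ u hu).trans (mul_le_mul_right (D.fst.total_le_extNorm N₀ N₁ f₀) _)
  have e₁ := (hB _ q₁ u hu).trans
    (mul_le_mul_right (mul_le_mul_right (D.snd.total_le_extNorm N₀ N₁ f₁) _) _)
  rw [ENNReal.coe_mul, mul_assoc]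
  refine mul_le_mul_right ((add_le_add e₀ e₁).trans ?_) _
  rw [mul_add, ENNReal.coe_add]
  gcongr
  · exact le_self_add
  · exact le_add_self

/-- The decomposition near-optimal at `u` for `(X₀, X₁)` serves as competitor at `ratio u` for the
interpolation couple. -/
theorem LCouple.exists_K_le_formula [IsTopologicalAddGroup V] [T2Space V] (D : LCouple)
    (h₀ : IsQuasiBanach 𝕜 N₀) (h₁ : IsQuasiBanach 𝕜 N₁) :
    ∃ C : ℝ≥0, ∀ f : V, MemSum N₀ N₁ f → ∀ u : ℝ, 0 < u →
      K (D.fst.extNorm N₀ N₁) (D.snd.extNorm N₀ N₁) (D.ratio u) f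
        ≤ C * D.formula (fun s => K N₀ N₁ (ENNReal.ofReal s) f) u := by
  obtain ⟨c, hc⟩ := exists_near_optimal h₀ h₁
  obtain ⟨A, hA⟩ := D.total_fst_le
  obtain ⟨B, hB⟩ := D.total_snd_le
  refine ⟨A * c + B * c, fun f hf u hu => ?_⟩
  obtain ⟨f₀, f₁, hff, hm₀, hm₁, e₁, e₂, e₃, e₄⟩ := hc f hf u hu
  have q := quasiConcave_K N₀ N₁ f
  refine (K_add_le_of_eq hff).trans ?_
  rw [LSpace.extNorm, LSpace.extNorm, if_pos hm₀, if_pos hm₁]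
  refine (add_le_add (hA c _ _ u hu q (quasiConcave_K N₀ N₁ f₀) e₁ e₂)
    (hB c _ _ u hu q (quasiConcave_K N₀ N₁ f₁) e₃ e₄)).trans_eq ?_
  push_cast
  ring

end Peetre

/-- The parameters of `(X₀, X₁)^𝓛_{θ,b,E,a,F}` as an `LSpace`. -/
def LSpace.ofSlowlyVarying (θ : ℝ) (hθ : 0 < θ) (hθ' : θ < 1) {a b : ℝ → ℝ} (E F : RISpace)
    (ha : SlowlyVarying a) (hb : SlowlyVarying b) (hbE : E.tildeOn (Ioi 1) (ennFun b) < ∞) :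
    LSpace where
  θ := θ
  v s := pw (-θ) s * ennFun a s
  b := ennFun b
  E := E
  F := F
  pos := hθ
  lt_one := hθ'
  regVar_v := ((RegVar.pw (-θ)).mul ha.regVar).congr (add_zero _) rfl
  regVar_b := hb.regVar
  tail_lt_top := hbE

theorem rho_eq (θ₀ θ₁ : ℝ) {a₀ a₁ b₀ b₁ : ℝ → ℝ} (E₀ E₁ : RISpace) {u : ℝ} (hu : 0 < u) :
    rho θ₀ θ₁ a₀ a₁ b₀ b₁ E₀ E₁ u
      = pw (-θ₀) u * ennFun a₀ u * E₀.tildeOn (Ioi u) (ennFun b₀) *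
        (pw (-θ₁) u * ennFun a₁ u * E₁.tildeOn (Ioi u) (ennFun b₁))⁻¹ := by
  have h : ENNReal.ofReal (u ^ (θ₁ - θ₀)) = pw (-θ₀) u * (pw (-θ₁) u)⁻¹ := by
    rw [← div_eq_mul_inv, ENNReal.eq_div_iff (pw_ne_zero _ hu) (pw_ne_top _ _),
      ← pw, ← pw_add _ _ hu]
    ring_nf
  rw [rho, h, mul_assoc (pw (-θ₁) u), ENNReal.mul_inv (.inl (pw_ne_zero _ hu))
    (.inl (pw_ne_top _ _)), div_eq_mul_inv]
  ring

end Holmstedt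

end

theorem theorem3p2 {𝕜 V : Type*} [RCLike 𝕜] [AddCommGroup V] [Module 𝕜 V]
    [TopologicalSpace V] [IsTopologicalAddGroup V] [ContinuousSMul 𝕜 V] [T2Space V]
    (X₀ X₁ : V → ℝ≥0∞)
    (hX₀ : Holmstedt.IsQuasiBanach 𝕜 X₀) (hX₁ : Holmstedt.IsQuasiBanach 𝕜 X₁)
    (θ₀ θ₁ : ℝ) (hθ₀ : 0 < θ₀) (hθ : θ₀ < θ₁) (hθ₁ : θ₁ < 1)
    (E₀ E₁ F₀ F₁ : Holmstedt.RISpace) (a₀ a₁ b₀ b₁ : ℝ → ℝ)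
    (ha₀ : Holmstedt.SlowlyVarying a₀) (ha₁ : Holmstedt.SlowlyVarying a₁)
    (hb₀ : Holmstedt.SlowlyVarying b₀) (hb₁ : Holmstedt.SlowlyVarying b₁)
    (hbE₀ : E₀.tildeOn (Ioi 1) (Holmstedt.ennFun b₀) < ∞)
    (hbE₁ : E₁.tildeOn (Ioi 1) (Holmstedt.ennFun b₁) < ∞) :
    let ρ : ℝ → ℝ≥0∞ := Holmstedt.rho θ₀ θ₁ a₀ a₁ b₀ b₁ E₀ E₁
    let Y₀ : V → ℝ≥0∞ := Holmstedt.normL X₀ X₁ θ₀ b₀ E₀ a₀ F₀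
    let Y₁ : V → ℝ≥0∞ := Holmstedt.normL X₀ X₁ θ₁ b₁ E₁ a₁ F₁
    let H : V → ℝ → ℝ≥0∞ := fun f u =>
      E₀.tildeOn (Ioo 0 u)
          (fun t => Holmstedt.ennFun b₀ t *
            F₀.tildeOn (Ioo 0 t) (Holmstedt.wK X₀ X₁ θ₀ a₀ f))
        + E₀.tildeOn (Ioi u) (Holmstedt.ennFun b₀) *
            F₀.tildeOn (Ioo 0 u) (Holmstedt.wK X₀ X₁ θ₀ a₀ f)
        + ρ u * E₁.tildeOn (Ioi u)
          (fun t => Holmstedt.ennFun b₁ t *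
            F₁.tildeOn (Ioo u t) (Holmstedt.wK X₀ X₁ θ₁ a₁ f))
    (∀ u : ℝ, 0 < u → 0 < ρ u ∧ ρ u < ∞) ∧
    ∃ C : ℝ≥0, 0 < C ∧ ∀ f : V, Holmstedt.MemSum Y₀ Y₁ f → ∀ u : ℝ, 0 < u →
      Holmstedt.K Y₀ Y₁ (ρ u) f ≤ C * H f u ∧ H f u ≤ C * Holmstedt.K Y₀ Y₁ (ρ u) f := by
  intro ρ Y₀ Y₁ H
  let D : Holmstedt.LCouple :=
    ⟨.ofSlowlyVarying θ₀ hθ₀ (hθ.trans hθ₁) E₀ F₀ ha₀ hb₀ hbE₀,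
      .ofSlowlyVarying θ₁ (hθ₀.trans hθ) hθ₁ E₁ F₁ ha₁ hb₁ hbE₁, hθ⟩
  have hρ : ∀ u, 0 < u → ρ u = D.ratio u := fun u hu => Holmstedt.rho_eq θ₀ θ₁ E₀ E₁ hu
  have hY₀ : Y₀ = D.fst.extNorm X₀ X₁ := rfl
  have hY₁ : Y₁ = D.snd.extNorm X₀ X₁ := rfl
  have hH : ∀ f u, 0 < u →
      H f u = D.formula (fun s => Holmstedt.K X₀ X₁ (ENNReal.ofReal s) f) u := fun f u hu => by
    simp only [H, hρ u hu]
    rfl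
  refine ⟨fun u hu => ?_, ?_⟩
  · rw [hρ u hu]
    exact ⟨pos_iff_ne_zero.2 (D.regVar_ratio.ne_zero u hu), (D.regVar_ratio.ne_top u hu).lt_top⟩
  obtain ⟨A, hA⟩ := D.exists_K_le_formula hX₀ hX₁
  obtain ⟨B, hB⟩ := D.exists_formula_le_K hX₀ hX₁
  -- The added `1` only ensures positivity.
  refine ⟨A + B + 1, by positivity, fun f hf u hu => ?_⟩
  obtain ⟨f₀, f₁, rfl, hf₀, hf₁⟩ := hf
  -- The near-optimal decomposition needs `f ∈ X₀ + X₁`, inherited from the two interpolation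
  -- spaces.
  have hmem : Holmstedt.MemSum X₀ X₁ (f₀ + f₁) :=
    (Holmstedt.LSpace.memSum_of_extNorm_lt_top (hY₀ ▸ hf₀)).add hX₀ hX₁
      (Holmstedt.LSpace.memSum_of_extNorm_lt_top (hY₁ ▸ hf₁))
  rw [hρ u hu, hH _ u hu, hY₀, hY₁]
  refine ⟨(hA _ hmem u hu).trans ?_, (hB _ u hu).trans ?_⟩
  · gcongr
    exact le_self_add.trans le_self_add
  · gcongr
    exact le_add_self.trans le_self_add
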